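/- Let $k$ be a field of characteristic zero (for instance $k=\mathbb{Q}$), let $\Xi$ be a set of colors, and let $\mathcal{O}$ be a $\Xi$-colored dg operad over $k$ with cohomology operad $\mathcal{H} := H^{\bullet}(\mathcal{O})$, regarded as a dg operad with zero differential. Let $P$ be a $\Xi$-colored dg pseudo-cooperad over $k$ (a dg cooperad without counit), let $P^{\diamondsuit}$ be the dg cooperad obtained from $P$ by formally adjoining a counit, and let $\mathrm{Cobar}(P^{\diamondsuit})$ be its cobar construction, that is, the free operad generated by the suspension $\mathbf{s} P$ (where $(\mathbf{s}P)^{n} = P^{n-1}$) with the differential determined by the differential and the comultiplications of $P$. Let $$\rho : \mathrm{Cobar}(P^{\diamondsuit}) \longrightarrow \mathcal{H}$$ be a quasi-isomorphism of dg operads. Assume: * **(C1)** $P$ carries an additional grading by subcollections, $P = \bigoplus_{j\ge 1} \mathcal{G}^j P$, with $\mathcal{G}^{0}P = 0$, such that $\partial_P(\mathcal{G}^j P) \subset \mathcal{G}^{j-1}P$ for all $j \ge 1$, and $\Delta_{\mathbf{t}}(\mathcal{G}^m P) \subset \bigoplus_{r_1+\dots+r_q=m} \mathcal{G}^{r_1}P\otimes\cdots\otimes\mathcal{G}^{r_q}P$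 for every $\Xi$-colored tree $\mathbf{t}$ with $q$ nodal vertices; * **(C2)** for every $\Xi$-colored corolla $\mathbf{q}$, each $\mathcal{G}^jP(\mathbf{q})$ is finite dimensional, and each graded component of $\mathcal{O}(\mathbf{q})$ is finite dimensional; * **(C3)** the operad $\mathcal{H}$ is generated by $\rho(\mathbf{s}\,\mathcal{G}^1P)$, and $\rho|_{\mathbf{s}\,\mathcal{G}^jP} = 0$ for all $j\ge 2$. For a dg operad $A$, let $\mathcal{Z}(A)$ be the suboperad of its cocycles; all vectors in $\mathbf{s}\,\mathcal{G}^1P$ are cocycles of $\mathrm{Cobar}(P^{\diamondsuit})$. Then: 1. Let $F : \mathrm{Cobar}(P^{\diamondsuit}) \to \mathcal{O}$ be a morphism of dg operads, and let $\pi_{\mathcal{H}} : \mathcal{Z}(\mathcal{O}) \to \mathcal{H}$ be the canonical projection. If the image of $\pi_{\mathcal{H}}\circ F|_{\mathbf{s}\,\mathcal{G}^1P} : \mathbf{s}\,\mathcal{G}^1P \to \mathcal{H}$ generates the operad $\mathcal{H}$, then $F$ is a quasi-isomorphism of dg operads. 2. Let $K$ be any field extension of $k$, let $F : \mathrm{Cobar}(P^{\diamondsuit})\otimes_k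 K \to \mathcal{O}\otimes_k K$ be a morphism of dg operads over $K$, and let $\pi : \mathcal{Z}(\mathcal{O}\otimes_k K) \to H^{\bullet}(\mathcal{O}\otimes_k K)$ be the canonical projection. If the image of $\pi\circ F|_{\mathbf{s}\,\mathcal{G}^1P}$ generates the operad $H^{\bullet}(\mathcal{O}\otimes_k K)$ over $K$, then $F$ is a quasi-isomorphism of dg operads. -/

import Mathlib

open scoped TensorProduct

universe u v w w₁ w₂ w₃

namespace OperadFormality

/-- A `Ξ`-colored corolla: `n` incoming edges, labelled by `Fin n`, with their colors, and the color
of the outgoing edge. -/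
structure Corolla (Ξ : Type v) where
  n : ℕ
  inp : Fin n → Ξ
  out : Ξ

/-- The corolla with one incoming edge, of the same color as its outgoing edge. -/
def Corolla.unit {Ξ : Type v} (c : Ξ) : Corolla Ξ := ⟨1, fun _ => c, c⟩

/-- A color preserving relabelling of the incoming edges of a corolla. -/
structure Relabel {Ξ : Type v} (p q : Corolla Ξ) where
  e : Fin p.n ≃ Fin q.n
  inp : ∀ j, q.inp (e j) = p.inp j
  out : q.out = p.out

/-- The identity relabelling. -/
def Relabel.refl {Ξ : Type v} (p : Corolla Ξ) : Relabel p p := ⟨Equiv.refl _, fun _ => rfl, rfl⟩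

/-- Composition of relabellings. -/
def Relabel.trans {Ξ : Type v} {p q r : Corolla Ξ} (σ : Relabel p q) (τ : Relabel q r) :
    Relabel p r :=
  ⟨σ.e.trans τ.e, fun j => (τ.inp _).trans (σ.inp j), τ.out.trans σ.out⟩

/-- A tree with exactly two nodal vertices, whose leaves are labelled by the incoming edges of `r`:
the lower vertex is the corolla `p`, the upper vertex is the corolla `q`, and the outgoing edge of
`q` is glued to the incoming edge `edge` of `p`. The bijection `e` says which incoming edge of `p`
or of `q` is the leaf `k` (namely `e (some k)`), respectively the internal edge (namely
`e none`). -/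
structure Graft {Ξ : Type v} (p q r : Corolla Ξ) where
  e : Option (Fin r.n) ≃ Fin p.n ⊕ Fin q.n
  edge : Fin p.n
  e_none : e none = Sum.inl edge
  edge_color : p.inp edge = q.out
  leaf_color : ∀ k, Sum.elim p.inp q.inp (e (some k)) = r.inp k
  out_color : p.out = r.out

/-- The relabellings `α`, `β` of the vertices and `υ` of the leaves form an isomorphism from the
tree `g` to the tree `g'`. -/
def Graft.IsIso {Ξ : Type v} {p q r p' q' r' : Corolla Ξ} (g : Graft p q r) (g' : Graft p' q' r')
    (α : Relabel p p') (β : Relabel q q') (υ : Relabel r r') : Prop :=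
  ∀ x, g'.e (Option.map υ.e x) = Sum.map α.e β.e (g.e x)

/-- Inserting `g₁` into the lower vertex of `g₂`, and inserting `h₁` into the upper vertex of
`h₂`, give the same tree with three vertices `p` (bottom), `q` (middle), `s` (top), one above the
other. -/
def SeqTree {Ξ : Type v} {p q s r t u : Corolla Ξ} (g₁ : Graft p q r) (g₂ : Graft r s t)
    (h₁ : Graft q s u) (h₂ : Graft p u t) : Prop :=
  h₂.edge = g₁.edge ∧ g₁.e (some g₂.edge) = Sum.inr h₁.edge ∧
  ∀ k, Sum.elim (fun y => Sum.map id Sum.inl (g₁.e (some y))) (fun z => Sum.inr (Sum.inr z))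
      (g₂.e (some k)) =
    (Sum.map id (fun y => h₁.e (some y)) (h₂.e (some k)) : Fin p.n ⊕ (Fin q.n ⊕ Fin s.n))

/-- Inserting `g₁` into the lower vertex of `g₂`, and inserting `h₁` into the lower vertex of
`h₂`, give the same tree with three vertices `p` (bottom), `q` and `s`, where `q` and `s` are both
attached to `p`. -/
def ParTree {Ξ : Type v} {p q s r t u : Corolla Ξ} (g₁ : Graft p q r) (g₂ : Graft r s t)
    (h₁ : Graft p s u) (h₂ : Graft u q t) : Prop :=
  g₁.e (some g₂.edge) = Sum.inl h₁.edge ∧ h₁.e (some h₂.edge) = Sum.inl g₁.edge ∧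
  ∀ k, Sum.elim (fun y => Sum.map id Sum.inl (g₁.e (some y))) (fun z => Sum.inr (Sum.inr z))
      (g₂.e (some k)) =
    (Sum.elim (fun y => Sum.map id Sum.inr (h₁.e (some y))) (fun z => Sum.inr (Sum.inl z))
      (h₂.e (some k)) : Fin p.n ⊕ (Fin q.n ⊕ Fin s.n))

/-- A `Ξ`-colored collection of cochain complexes of `k`-vector spaces. -/
structure DGCollection (k : Type u) [Field k] (Ξ : Type v) where
  X : Corolla Ξ → ℤ → Type w
  [addCommGroup : ∀ r n, AddCommGroup (X r n)]
  [module : ∀ r n, Module k (X r n)]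
  d : ∀ {r : Corolla Ξ} {m n : ℤ}, m + 1 = n → (X r m →ₗ[k] X r n)
  d_d : ∀ {r : Corolla Ξ} {l m n : ℤ} (h : l + 1 = m) (h' : m + 1 = n) (x : X r l),
    d h' (d h x) = 0
  act : ∀ {p q : Corolla Ξ} {n : ℤ}, Relabel p q → (X p n →ₗ[k] X q n)
  act_refl : ∀ {p : Corolla Ξ} {n : ℤ} (x : X p n), act (Relabel.refl p) x = x
  act_trans : ∀ {p q r : Corolla Ξ} {n : ℤ} (σ : Relabel p q) (τ : Relabel q r) (x : X p n),
    act (σ.trans τ) x = act τ (act σ x)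
  act_d : ∀ {p q : Corolla Ξ} {m n : ℤ} (h : m + 1 = n) (σ : Relabel p q) (x : X p m),
    act σ (d h x) = d h (act σ x)

attribute [instance] DGCollection.addCommGroup DGCollection.module

/-- A `Ξ`-colored dg operad, in terms of the insertions along trees with two vertices. -/
structure DGOperad (k : Type u) [Field k] (Ξ : Type v) extends DGCollection.{u, v, w} k Ξ where
  one : ∀ c : Ξ, X (Corolla.unit c) 0
  comp : ∀ {p q r : Corolla Ξ} {m n l : ℤ}, Graft p q r → m + n = l →
    (X p m →ₗ[k] X q n →ₗ[k] X r l)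
  d_comp : ∀ {p q r : Corolla Ξ} {m n l m' n' l' : ℤ} (g : Graft p q r) (h : m + n = l)
    (hm : m + 1 = m') (hn : n + 1 = n') (hl : l + 1 = l') (h₁ : m' + n = l') (h₂ : m + n' = l')
    (x : X p m) (y : X q n),
    d hl (comp g h x y) = comp g h₁ (d hm x) y + m.negOnePow • comp g h₂ x (d hn y)
  comp_act : ∀ {p q r p' q' r' : Corolla Ξ} {m n l : ℤ} (g : Graft p q r) (g' : Graft p' q' r')
    (α : Relabel p p') (β : Relabel q q') (υ : Relabel r r'), g.IsIso g' α β υ →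
    ∀ (h : m + n = l) (x : X p m) (y : X q n),
    comp g' h (act α x) (act β y) = act υ (comp g h x y)
  one_comp : ∀ {c : Ξ} {q r : Corolla Ξ} {n : ℤ} (g : Graft (Corolla.unit c) q r)
    (σ : Relabel q r), (∀ j, g.e (some (σ.e j)) = Sum.inr j) →
    ∀ y : X q n, comp g (zero_add n) (one c) y = act σ y
  comp_one : ∀ {c : Ξ} {p r : Corolla Ξ} {n : ℤ} (g : Graft p (Corolla.unit c) r)
    (σ : Relabel p r),
    (∀ j, g.e (some (σ.e j)) = if j = g.edge then Sum.inr (0 : Fin 1) else Sum.inl j) →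
    ∀ x : X p n, comp g (add_zero n) x (one c) = act σ x
  comp_seq : ∀ {p q s r t u : Corolla Ξ} {m n l a b c : ℤ} (g₁ : Graft p q r) (g₂ : Graft r s t)
    (h₁ : Graft q s u) (h₂ : Graft p u t), SeqTree g₁ g₂ h₁ h₂ →
    ∀ (ha : m + n = a) (hc : a + l = c) (hb : n + l = b) (hc' : m + b = c)
    (x : X p m) (y : X q n) (z : X s l),
    comp g₂ hc (comp g₁ ha x y) z = comp h₂ hc' x (comp h₁ hb y z)
  comp_par : ∀ {p q s r t u : Corolla Ξ} {m n l a b c : ℤ} (g₁ : Graft p q r) (g₂ : Graft r s t)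
    (h₁ : Graft p s u) (h₂ : Graft u q t), ParTree g₁ g₂ h₁ h₂ →
    ∀ (ha : m + n = a) (hc : a + l = c) (hb : m + l = b) (hc' : b + n = c)
    (x : X p m) (y : X q n) (z : X s l),
    comp g₂ hc (comp g₁ ha x y) z = (n * l).negOnePow • comp h₂ hc' (comp h₁ hb x z) y

/-- A `Ξ`-colored dg pseudo-cooperad (that is, a dg cooperad without counit), in terms of the
components `X r n → X p i ⊗ X q j` of the comultiplications for trees with two vertices; every
vector has only finitely many nonzero components. -/
structure DGPseudoCooperad (k : Type u) [Field k] (Ξ : Type v) extends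
    DGCollection.{u, v, w} k Ξ where
  Δ : ∀ {p q r : Corolla Ξ} {i j n : ℤ}, Graft p q r → i + j = n →
    (X r n →ₗ[k] X p i ⊗[k] X q j)
  finite_Δ : ∀ {r : Corolla Ξ} {n : ℤ} (x : X r n),
    {t : (Σ p q : Corolla Ξ, Graft p q r) × ℤ |
      Δ t.1.2.2 (add_sub_cancel t.2 n) x ≠ 0}.Finite
  Δ_d : ∀ {p q r : Corolla Ξ} {i j n i' j' n' : ℤ} (g : Graft p q r) (hi : i + 1 = i')
    (hj : j + 1 = j') (hn : n + 1 = n') (h : i' + j' = n') (h₁ : i + j' = n) (h₂ : i' + j = n)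
    (x : X r n),
    Δ g h (d hn x) = TensorProduct.map (d hi) LinearMap.id (Δ g h₁ x) +
      i'.negOnePow • TensorProduct.map LinearMap.id (d hj) (Δ g h₂ x)
  Δ_act : ∀ {p q r p' q' r' : Corolla Ξ} {i j n : ℤ} (g : Graft p q r) (g' : Graft p' q' r')
    (α : Relabel p p') (β : Relabel q q') (υ : Relabel r r'), g.IsIso g' α β υ →
    ∀ (h : i + j = n) (x : X r n),
    Δ g' h (act υ x) = TensorProduct.map (act α) (act β) (Δ g h x)
  Δ_seq : ∀ {p q s r t u : Corolla Ξ} {m n l a b c : ℤ} (g₁ : Graft p q r) (g₂ : Graft r s t)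
    (h₁ : Graft q s u) (h₂ : Graft p u t), SeqTree g₁ g₂ h₁ h₂ →
    ∀ (ha : m + n = a) (hc : a + l = c) (hb : n + l = b) (hc' : m + b = c) (x : X t c),
    TensorProduct.assoc k _ _ _ (TensorProduct.map (Δ g₁ ha) LinearMap.id (Δ g₂ hc x)) =
      TensorProduct.map LinearMap.id (Δ h₁ hb) (Δ h₂ hc' x)
  Δ_par : ∀ {p q s r t u : Corolla Ξ} {m n l a b c : ℤ} (g₁ : Graft p q r) (g₂ : Graft r s t)
    (h₁ : Graft p s u) (h₂ : Graft u q t), ParTree g₁ g₂ h₁ h₂ →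
    ∀ (ha : m + n = a) (hc : a + l = c) (hb : m + l = b) (hc' : b + n = c) (x : X t c),
    TensorProduct.map (Δ g₁ ha) LinearMap.id (Δ g₂ hc x) =
      (n * l).negOnePow • TensorProduct.rightComm k _ _ _
        (TensorProduct.map (Δ h₁ hb) LinearMap.id (Δ h₂ hc' x))

/-! ### Morphisms, cohomology, quasi-isomorphisms -/

namespace DGOperad

variable {k : Type u} [Field k] {Ξ : Type v}

/-- A morphism of dg operads. -/
structure Hom (A : DGOperad.{u, v, w₁} k Ξ) (B : DGOperad.{u, v, w₂} k Ξ) where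
  f : ∀ {r : Corolla Ξ} {n : ℤ}, A.X r n →ₗ[k] B.X r n
  f_d : ∀ {r : Corolla Ξ} {m n : ℤ} (h : m + 1 = n) (x : A.X r m), f (A.d h x) = B.d h (f x)
  f_act : ∀ {p q : Corolla Ξ} {n : ℤ} (σ : Relabel p q) (x : A.X p n),
    f (A.act σ x) = B.act σ (f x)
  f_one : ∀ c, f (A.one c) = B.one c
  f_comp : ∀ {p q r : Corolla Ξ} {m n l : ℤ} (g : Graft p q r) (h : m + n = l) (x : A.X p m)
    (y : A.X q n), f (A.comp g h x y) = B.comp g h (f x) (f y)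

/-- The cocycles of degree `n`. -/
def cocycles (O : DGOperad.{u, v, w} k Ξ) (r : Corolla Ξ) (n : ℤ) : Submodule k (O.X r n) :=
  LinearMap.ker (O.d (rfl : n + 1 = n + 1))

/-- The coboundaries of degree `n`, as a subspace of the cocycles. -/
def coboundaries (O : DGOperad.{u, v, w} k Ξ) (r : Corolla Ξ) (n : ℤ) :
    Submodule k (O.cocycles r n) :=
  (LinearMap.range (O.d (sub_add_cancel n 1))).comap (O.cocycles r n).subtype

theorem mem_cocycles (O : DGOperad.{u, v, w} k Ξ) {r : Corolla Ξ} {m n : ℤ} (h : m + 1 = n)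
    (x : O.X r m) : x ∈ O.cocycles r m ↔ O.d h x = 0 := by
  subst h; exact LinearMap.mem_ker

theorem mem_coboundaries (O : DGOperad.{u, v, w} k Ξ) {r : Corolla Ξ} {m n : ℤ} (h : m + 1 = n)
    (x : O.cocycles r n) : x ∈ O.coboundaries r n ↔ ∃ y : O.X r m, O.d h y = x := by
  obtain rfl : m = n - 1 := by omega
  exact Iff.rfl

/-- The space of cohomology classes of degree `n`. -/
abbrev Cohomology (O : DGOperad.{u, v, w} k Ξ) (r : Corolla Ξ) (n : ℤ) : Type w :=
  O.cocycles r n ⧸ O.coboundaries r n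

/-- The projection from cocycles to cohomology. -/
def proj (O : DGOperad.{u, v, w} k Ξ) {r : Corolla Ξ} {n : ℤ} :
    O.cocycles r n →ₗ[k] O.Cohomology r n :=
  (O.coboundaries r n).mkQ

theorem act_mem (O : DGOperad.{u, v, w} k Ξ) {p q : Corolla Ξ} {n : ℤ} (σ : Relabel p q)
    {x : O.X p n} (hx : x ∈ O.cocycles p n) : O.act σ x ∈ O.cocycles q n := by
  rw [O.mem_cocycles rfl] at hx ⊢
  rw [← O.act_d, hx, map_zero]

theorem comp_mem (O : DGOperad.{u, v, w} k Ξ) {p q r : Corolla Ξ} {m n l : ℤ} (g : Graft p q r)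
    (h : m + n = l) {x : O.X p m} (hx : x ∈ O.cocycles p m) {y : O.X q n}
    (hy : y ∈ O.cocycles q n) : O.comp g h x y ∈ O.cocycles r l := by
  rw [O.mem_cocycles rfl] at hx hy ⊢
  rw [O.d_comp g h rfl rfl rfl (by omega) (by omega), hx, hy]
  simp

/-- The unit is a cocycle. -/
theorem one_mem (O : DGOperad.{u, v, w} k Ξ) (c : Ξ) :
    O.one c ∈ O.cocycles (Corolla.unit c) 0 := by
  let g : Graft (Corolla.unit c) (Corolla.unit c) (Corolla.unit c) :=
    { e := ⟨fun x => x.elim (Sum.inl (0 : Fin 1)) fun _ => Sum.inr (0 : Fin 1),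
        Sum.elim (fun _ => none) fun _ => some (0 : Fin 1),
        fun x => by
          cases x with
          | none => rfl
          | some j => exact congrArg some (Subsingleton.elim (α := Fin 1) _ _),
        fun x => by
          cases x with
          | inl j => exact congrArg Sum.inl (Subsingleton.elim (α := Fin 1) _ _)
          | inr j => exact congrArg Sum.inr (Subsingleton.elim (α := Fin 1) _ _)⟩
      edge := (0 : Fin 1)
      e_none := rfl
      edge_color := rfl
      leaf_color := fun _ => rfl
      out_color := rfl }
  rw [O.mem_cocycles (zero_add 1)]
  have hg : ∀ {n : ℤ} (y : O.X (Corolla.unit c) n), O.comp g (zero_add n) (O.one c) y = y := by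
    intro n y
    rw [O.one_comp g (Relabel.refl _) (fun j =>
      congrArg Sum.inr (Subsingleton.elim (α := Fin 1) _ _)), O.act_refl]
  have hg' : ∀ {n : ℤ} (y : O.X (Corolla.unit c) n), O.comp g (add_zero n) y (O.one c) = y := by
    intro n y
    rw [O.comp_one g (Relabel.refl _) (fun j => by
      have : j = g.edge := Subsingleton.elim (α := Fin 1) _ _
      rw [if_pos this]; rfl), O.act_refl]
  have := O.d_comp g (zero_add 0) (zero_add 1) (zero_add 1) (zero_add 1) (by norm_num)
    (by norm_num) (O.one c) (O.one c)
  rw [hg (O.one c), hg' (O.d _ _), hg (O.d _ _)] at this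
  simpa using this

/-- The map on cohomology induced by the action of a relabelling. -/
def cohomologyAct (O : DGOperad.{u, v, w} k Ξ) {p q : Corolla Ξ} {n : ℤ} (σ : Relabel p q) :
    O.Cohomology p n →ₗ[k] O.Cohomology q n :=
  Submodule.mapQ _ _ ((O.act σ).restrict fun _ hx => O.act_mem σ hx) (by
    intro x hx
    rw [O.mem_coboundaries (sub_add_cancel n 1)] at hx
    obtain ⟨y, hy⟩ := hx
    rw [Submodule.mem_comap, O.mem_coboundaries (sub_add_cancel n 1)]
    exact ⟨O.act σ y, by rw [← O.act_d, hy]; rfl⟩)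

/-- The insertion of cocycles. -/
def cocyclesComp (O : DGOperad.{u, v, w} k Ξ) {p q r : Corolla Ξ} {m n l : ℤ} (g : Graft p q r)
    (h : m + n = l) : O.cocycles p m →ₗ[k] O.cocycles q n →ₗ[k] O.cocycles r l :=
  LinearMap.mk₂ k (fun x y => ⟨O.comp g h x y, O.comp_mem g h x.2 y.2⟩)
    (fun _ _ _ => Subtype.ext (by simp)) (fun _ _ _ => Subtype.ext (by simp))
    (fun _ _ _ => Subtype.ext (by simp)) (fun _ _ _ => Subtype.ext (by simp))

/-- The insertion of cohomology classes. -/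
def cohomologyComp (O : DGOperad.{u, v, w} k Ξ) {p q r : Corolla Ξ} {m n l : ℤ}
    (g : Graft p q r) (h : m + n = l) :
    O.Cohomology p m →ₗ[k] O.Cohomology q n →ₗ[k] O.Cohomology r l :=
  LinearMap.liftQ₂ (O.coboundaries p m) (O.coboundaries q n)
    ((O.cocyclesComp g h).compr₂ O.proj)
    (by
      intro x hx
      obtain ⟨y, hy⟩ := (O.mem_coboundaries (sub_add_cancel m 1) x).1 hx
      rw [LinearMap.mem_ker]
      ext z
      refine (Submodule.Quotient.mk_eq_zero _).2
        ((O.mem_coboundaries (sub_add_cancel l 1) _).2 ⟨O.comp g (by omega : m - 1 + n = l - 1) y z, ?_⟩)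
      rw [O.d_comp g _ (sub_add_cancel m 1) rfl _ h (by omega), hy,
        (O.mem_cocycles rfl _).1 z.2]
      simp [cocyclesComp])
    (by
      intro x hx
      obtain ⟨y, hy⟩ := (O.mem_coboundaries (sub_add_cancel n 1) x).1 hx
      rw [LinearMap.mem_ker]
      ext z
      refine (Submodule.Quotient.mk_eq_zero _).2
        ((O.mem_coboundaries (sub_add_cancel l 1) _).2
          ⟨m.negOnePow • O.comp g (by omega : m + (n - 1) = l - 1) z y, ?_⟩)
      rw [Units.smul_def, map_zsmul, ← Units.smul_def,
        O.d_comp g _ rfl (sub_add_cancel n 1) _ (by omega) h, hy,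
        (O.mem_cocycles rfl _).1 z.2]
      simp [cocyclesComp, smul_smul])

/-- The cohomology operad `H(O)`, a dg operad with zero differential. -/
def cohomology (O : DGOperad.{u, v, w} k Ξ) : DGOperad.{u, v, w} k Ξ where
  X := O.Cohomology
  d _ := 0
  d_d _ _ _ := rfl
  act σ := O.cohomologyAct σ
  act_refl x := by
    induction x using Submodule.Quotient.induction_on with
    | H x => exact congrArg O.proj (Subtype.ext (O.act_refl _))
  act_trans σ τ x := by
    induction x using Submodule.Quotient.induction_on with
    | H x => exact congrArg O.proj (Subtype.ext (O.act_trans _ _ _))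
  act_d _ _ _ := by simp
  one c := O.proj ⟨O.one c, O.one_mem c⟩
  comp g h := O.cohomologyComp g h
  d_comp _ _ _ _ _ _ _ _ _ := by simp
  comp_act g g' α β υ hg h x y := by
    induction x using Submodule.Quotient.induction_on with
    | H x =>
      induction y using Submodule.Quotient.induction_on with
      | H y => exact congrArg O.proj (Subtype.ext (O.comp_act g g' α β υ hg h _ _))
  one_comp g σ hg y := by
    induction y using Submodule.Quotient.induction_on with
    | H y => exact congrArg O.proj (Subtype.ext (O.one_comp g σ hg _))
  comp_one g σ hg x := by
    induction x using Submodule.Quotient.induction_on with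
    | H x => exact congrArg O.proj (Subtype.ext (O.comp_one g σ hg _))
  comp_seq g₁ g₂ h₁ h₂ H ha hc hb hc' x y z := by
    induction x using Submodule.Quotient.induction_on with
    | H x =>
      induction y using Submodule.Quotient.induction_on with
      | H y =>
        induction z using Submodule.Quotient.induction_on with
        | H z =>
          exact congrArg O.proj (Subtype.ext (O.comp_seq g₁ g₂ h₁ h₂ H ha hc hb hc' _ _ _))
  comp_par g₁ g₂ h₁ h₂ H ha hc hb hc' x y z := by
    induction x using Submodule.Quotient.induction_on with
    | H x =>
      induction y using Submodule.Quotient.induction_on with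
      | H y =>
        induction z using Submodule.Quotient.induction_on with
        | H z =>
          refine (congrArg O.proj (Subtype.ext
            (O.comp_par g₁ g₂ h₁ h₂ H ha hc hb hc' x.1 y.1 z.1) :
            O.cocyclesComp g₂ hc (O.cocyclesComp g₁ ha x y) z =
              (Int.negOnePow _).val • O.cocyclesComp h₂ hc' (O.cocyclesComp h₁ hb x z) y)).trans ?_
          rw [map_zsmul]
          rfl

/-- The map on cocycles induced by a morphism of dg operads. -/
def Hom.cocyclesMap {A : DGOperad.{u, v, w₁} k Ξ} {B : DGOperad.{u, v, w₂} k Ξ} (F : Hom A B)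
    (r : Corolla Ξ) (n : ℤ) : A.cocycles r n →ₗ[k] B.cocycles r n :=
  F.f.restrict fun x hx => by
    rw [mem_cocycles _ rfl] at hx ⊢
    rw [← F.f_d, hx, map_zero]

/-- The map on cohomology induced by a morphism of dg operads. -/
def Hom.cohomologyMap {A : DGOperad.{u, v, w₁} k Ξ} {B : DGOperad.{u, v, w₂} k Ξ} (F : Hom A B)
    (r : Corolla Ξ) (n : ℤ) : A.Cohomology r n →ₗ[k] B.Cohomology r n :=
  Submodule.mapQ _ _ (F.cocyclesMap r n) (by
    intro x hx
    rw [A.mem_coboundaries (sub_add_cancel n 1)] at hx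
    obtain ⟨y, hy⟩ := hx
    rw [Submodule.mem_comap, B.mem_coboundaries (sub_add_cancel n 1)]
    exact ⟨F.f y, by rw [← F.f_d, hy]; rfl⟩)

/-- The cohomology classes of the images under `F` of the cocycles in `S`. -/
def Hom.classes {A : DGOperad.{u, v, w₁} k Ξ} {B : DGOperad.{u, v, w₂} k Ξ} (F : Hom A B)
    (S : ∀ r n, Set (A.X r n)) (r : Corolla Ξ) (n : ℤ) : Set (B.cohomology.X r n) :=
  {y | ∃ z : A.cocycles r n, (z : A.X r n) ∈ S r n ∧ B.proj (F.cocyclesMap r n z) = y}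

/-- A morphism of dg operads is a quasi-isomorphism if it induces isomorphisms on cohomology. -/
def Hom.IsQuasiIso {A : DGOperad.{u, v, w₁} k Ξ} {B : DGOperad.{u, v, w₂} k Ξ} (F : Hom A B) :
    Prop :=
  ∀ r n, Function.Bijective (F.cohomologyMap r n)

/-- The graded suboperad generated by a family `S` of sets of homogeneous vectors. -/
inductive Generated (O : DGOperad.{u, v, w} k Ξ) (S : ∀ r n, Set (O.X r n)) :
    ∀ {r : Corolla Ξ} {n : ℤ}, O.X r n → Prop
  | basic {r : Corolla Ξ} {n : ℤ} (x : O.X r n) : x ∈ S r n → Generated O S x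
  | zero {r : Corolla Ξ} {n : ℤ} : Generated O S (0 : O.X r n)
  | add {r : Corolla Ξ} {n : ℤ} (x y : O.X r n) :
      Generated O S x → Generated O S y → Generated O S (x + y)
  | smul {r : Corolla Ξ} {n : ℤ} (a : k) (x : O.X r n) : Generated O S x → Generated O S (a • x)
  | act {p q : Corolla Ξ} {n : ℤ} (σ : Relabel p q) (x : O.X p n) :
      Generated O S x → Generated O S (O.act σ x)
  | one (c : Ξ) : Generated O S (O.one c)
  | comp {p q r : Corolla Ξ} {m n l : ℤ} (g : Graft p q r) (h : m + n = l) (x : O.X p m)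
      (y : O.X q n) : Generated O S x → Generated O S y → Generated O S (O.comp g h x y)

/-- The family `S` generates the operad `O`. -/
def IsGeneratedBy (O : DGOperad.{u, v, w} k Ξ) (S : ∀ r n, Set (O.X r n)) : Prop :=
  ∀ (r : Corolla Ξ) (n : ℤ) (x : O.X r n), Generated O S x

theorem tmul_sign {K : Type w₃} [Field K] [Algebra k K] {V : Type w} [AddCommGroup V] [Module k V]
    (n : ℤ) (a : K) (x : V) : a ⊗ₜ[k] (n.negOnePow • x) = n.negOnePow • (a ⊗ₜ[k] x) := by
  rw [Units.smul_def, Units.smul_def, TensorProduct.tmul_smul]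

/-- Extension of scalars `O ⊗ K`. -/
def baseChange (O : DGOperad.{u, v, w} k Ξ) (K : Type w₃) [Field K] [Algebra k K] :
    DGOperad.{w₃, v, max w₃ w} K Ξ where
  X r n := K ⊗[k] O.X r n
  d h := (O.d h).baseChange K
  d_d h h' x := by
    induction x using TensorProduct.induction_on with
    | zero => simp
    | tmul a x => simp [O.d_d]
    | add x y hx hy => simp only [map_add, hx, hy, add_zero]
  act σ := (O.act σ).baseChange K
  act_refl x := by
    induction x using TensorProduct.induction_on with
    | zero => simp
    | tmul a x => simp [O.act_refl]
    | add x y hx hy => simp only [map_add, hx, hy]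
  act_trans σ τ x := by
    induction x using TensorProduct.induction_on with
    | zero => simp
    | tmul a x => simp [O.act_trans]
    | add x y hx hy => simp only [map_add, hx, hy]
  act_d h σ x := by
    induction x using TensorProduct.induction_on with
    | zero => simp
    | tmul a x => simp [O.act_d]
    | add x y hx hy => simp only [map_add, hx, hy]
  one c := 1 ⊗ₜ O.one c
  comp g h := LinearMap.liftBaseChange K (LinearMap.baseChangeHom k K _ _ ∘ₗ O.comp g h)
  d_comp {p q r m n l m' n' l'} g h hm hn hl h₁ h₂ x y := by
    induction x using TensorProduct.induction_on with
    | zero => simp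
    | tmul a x =>
      induction y using TensorProduct.induction_on with
      | zero => simp
      | tmul b y =>
        simp only [LinearMap.liftBaseChange_tmul, LinearMap.comp_apply, LinearMap.smul_apply,
          LinearMap.baseChangeHom_apply, LinearMap.baseChange_tmul, map_smul,
          O.d_comp g h hm hn hl h₁ h₂, TensorProduct.tmul_add, tmul_sign, smul_add]
        rw [smul_comm a m.negOnePow]
      | add x y hx hy => simp only [map_add, hx, hy, smul_add]; abel
    | add x y hx hy => simp only [map_add, LinearMap.add_apply, hx, hy, smul_add]; abel
  comp_act g g' α β υ hg h x y := by
    induction x using TensorProduct.induction_on with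
    | zero => simp
    | tmul a x =>
      induction y using TensorProduct.induction_on with
      | zero => simp
      | tmul b y => simp [O.comp_act g g' α β υ hg h]
      | add x y hx hy => simp only [map_add, hx, hy]
    | add x y hx hy => simp only [map_add, LinearMap.add_apply, hx, hy]
  one_comp g σ hg y := by
    induction y using TensorProduct.induction_on with
    | zero => simp
    | tmul b y => simp [O.one_comp g σ hg]
    | add x y hx hy => simp only [map_add, hx, hy]
  comp_one g σ hg y := by
    induction y using TensorProduct.induction_on with
    | zero => simp
    | tmul b y => simp [O.comp_one g σ hg, TensorProduct.smul_tmul']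
    | add x y hx hy => simp only [map_add, LinearMap.add_apply, hx, hy]
  comp_seq g₁ g₂ h₁ h₂ H ha hc hb hc' x y z := by
    induction x using TensorProduct.induction_on with
    | zero => simp
    | tmul a x =>
      induction y using TensorProduct.induction_on with
      | zero => simp
      | tmul b y =>
        induction z using TensorProduct.induction_on with
        | zero => simp
        | tmul c z =>
          simp [O.comp_seq g₁ g₂ h₁ h₂ H ha hc hb hc', TensorProduct.smul_tmul', mul_assoc]
        | add x y hx hy => simp only [map_add, hx, hy]
      | add x y hx hy => simp only [map_add, LinearMap.add_apply, hx, hy]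
    | add x y hx hy => simp only [map_add, LinearMap.add_apply, hx, hy]
  comp_par g₁ g₂ h₁ h₂ H ha hc hb hc' x y z := by
    induction x using TensorProduct.induction_on with
    | zero => simp
    | tmul a x =>
      induction y using TensorProduct.induction_on with
      | zero => simp
      | tmul b y =>
        induction z using TensorProduct.induction_on with
        | zero => simp
        | tmul c z =>
          simp only [LinearMap.liftBaseChange_tmul, LinearMap.comp_apply, LinearMap.smul_apply,
            LinearMap.baseChangeHom_apply, LinearMap.baseChange_tmul,
            O.comp_par g₁ g₂ h₁ h₂ H ha hc hb hc', tmul_sign, TensorProduct.smul_tmul',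
            smul_eq_mul]
          rw [smul_comm, TensorProduct.smul_tmul', smul_eq_mul, mul_right_comm]
        | add x y hx hy => simp only [map_add, LinearMap.add_apply, smul_add, hx, hy]
      | add x y hx hy => simp only [map_add, LinearMap.add_apply, smul_add, hx, hy]
    | add x y hx hy => simp only [map_add, LinearMap.add_apply, smul_add, hx, hy]

end DGOperad

/-! ### The free operad on the suspension of a collection -/

/-- Formal expressions in the generators `s x` (of degree `|x| + 1`) and the operations of an
operad. -/
inductive Expr {k : Type u} [Field k] {Ξ : Type v} (P : DGCollection.{u, v, w} k Ξ) :
    Corolla Ξ → ℤ → Type (max u v w)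
  | gen {r : Corolla Ξ} {n m : ℤ} (h : n + 1 = m) (x : P.X r n) : Expr P r m
  | one (c : Ξ) : Expr P (Corolla.unit c) 0
  | act {p q : Corolla Ξ} {n : ℤ} (σ : Relabel p q) (a : Expr P p n) : Expr P q n
  | comp {p q r : Corolla Ξ} {m n l : ℤ} (g : Graft p q r) (h : m + n = l) (a : Expr P p m)
      (b : Expr P q n) : Expr P r l
  | zero {r : Corolla Ξ} {n : ℤ} : Expr P r n
  | add {r : Corolla Ξ} {n : ℤ} (a b : Expr P r n) : Expr P r n
  | smul {r : Corolla Ξ} {n : ℤ} (c : k) (a : Expr P r n) : Expr P r n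

/-- The least congruence for which the expressions form a graded operad and `s` is a map of
collections. -/
inductive Expr.Rel {k : Type u} [Field k] {Ξ : Type v} {P : DGCollection.{u, v, w} k Ξ} :
    ∀ {r : Corolla Ξ} {n : ℤ}, Expr P r n → Expr P r n → Prop
  | refl {r : Corolla Ξ} {n : ℤ} (a : Expr P r n) : Rel a a
  | symm {r : Corolla Ξ} {n : ℤ} {a b : Expr P r n} : Rel a b → Rel b a
  | trans {r : Corolla Ξ} {n : ℤ} {a b c : Expr P r n} : Rel a b → Rel b c → Rel a c
  | act_congr {p q : Corolla Ξ} {n : ℤ} (σ : Relabel p q) {a b : Expr P p n} :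
      Rel a b → Rel (.act σ a) (.act σ b)
  | comp_congr {p q r : Corolla Ξ} {m n l : ℤ} (g : Graft p q r) (h : m + n = l)
      {a a' : Expr P p m} {b b' : Expr P q n} :
      Rel a a' → Rel b b' → Rel (.comp g h a b) (.comp g h a' b')
  | add_congr {r : Corolla Ξ} {n : ℤ} {a a' b b' : Expr P r n} :
      Rel a a' → Rel b b' → Rel (.add a b) (.add a' b')
  | smul_congr {r : Corolla Ξ} {n : ℤ} (c : k) {a a' : Expr P r n} :
      Rel a a' → Rel (.smul c a) (.smul c a')
  | add_comm {r : Corolla Ξ} {n : ℤ} (a b : Expr P r n) : Rel (.add a b) (.add b a)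
  | add_assoc {r : Corolla Ξ} {n : ℤ} (a b c : Expr P r n) :
      Rel (.add (.add a b) c) (.add a (.add b c))
  | zero_add {r : Corolla Ξ} {n : ℤ} (a : Expr P r n) : Rel (.add .zero a) a
  | one_smul {r : Corolla Ξ} {n : ℤ} (a : Expr P r n) : Rel (.smul 1 a) a
  | zero_smul {r : Corolla Ξ} {n : ℤ} (a : Expr P r n) : Rel (.smul 0 a) .zero
  | mul_smul {r : Corolla Ξ} {n : ℤ} (c c' : k) (a : Expr P r n) :
      Rel (.smul (c * c') a) (.smul c (.smul c' a))
  | add_smul {r : Corolla Ξ} {n : ℤ} (c c' : k) (a : Expr P r n) :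
      Rel (.smul (c + c') a) (.add (.smul c a) (.smul c' a))
  | smul_add {r : Corolla Ξ} {n : ℤ} (c : k) (a b : Expr P r n) :
      Rel (.smul c (.add a b)) (.add (.smul c a) (.smul c b))
  | gen_add {r : Corolla Ξ} {n m : ℤ} (h : n + 1 = m) (x y : P.X r n) :
      Rel (.gen h (x + y)) (.add (.gen h x) (.gen h y))
  | gen_smul {r : Corolla Ξ} {n m : ℤ} (h : n + 1 = m) (c : k) (x : P.X r n) :
      Rel (.gen h (c • x)) (.smul c (.gen h x))
  | gen_act {p q : Corolla Ξ} {n m : ℤ} (h : n + 1 = m) (σ : Relabel p q) (x : P.X p n) :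
      Rel (.gen h (P.act σ x)) (.act σ (.gen h x))
  | act_add {p q : Corolla Ξ} {n : ℤ} (σ : Relabel p q) (a b : Expr P p n) :
      Rel (.act σ (.add a b)) (.add (.act σ a) (.act σ b))
  | act_smul {p q : Corolla Ξ} {n : ℤ} (σ : Relabel p q) (c : k) (a : Expr P p n) :
      Rel (.act σ (.smul c a)) (.smul c (.act σ a))
  | act_refl {p : Corolla Ξ} {n : ℤ} (a : Expr P p n) : Rel (.act (Relabel.refl p) a) a
  | act_trans {p q r : Corolla Ξ} {n : ℤ} (σ : Relabel p q) (τ : Relabel q r) (a : Expr P p n) :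
      Rel (.act (σ.trans τ) a) (.act τ (.act σ a))
  | add_comp {p q r : Corolla Ξ} {m n l : ℤ} (g : Graft p q r) (h : m + n = l)
      (a a' : Expr P p m) (b : Expr P q n) :
      Rel (.comp g h (.add a a') b) (.add (.comp g h a b) (.comp g h a' b))
  | smul_comp {p q r : Corolla Ξ} {m n l : ℤ} (g : Graft p q r) (h : m + n = l) (c : k)
      (a : Expr P p m) (b : Expr P q n) :
      Rel (.comp g h (.smul c a) b) (.smul c (.comp g h a b))
  | comp_add {p q r : Corolla Ξ} {m n l : ℤ} (g : Graft p q r) (h : m + n = l)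
      (a : Expr P p m) (b b' : Expr P q n) :
      Rel (.comp g h a (.add b b')) (.add (.comp g h a b) (.comp g h a b'))
  | comp_smul {p q r : Corolla Ξ} {m n l : ℤ} (g : Graft p q r) (h : m + n = l) (c : k)
      (a : Expr P p m) (b : Expr P q n) :
      Rel (.comp g h a (.smul c b)) (.smul c (.comp g h a b))
  | comp_act {p q r p' q' r' : Corolla Ξ} {m n l : ℤ} (g : Graft p q r) (g' : Graft p' q' r')
      (α : Relabel p p') (β : Relabel q q') (υ : Relabel r r') (H : g.IsIso g' α β υ)
      (h : m + n = l) (a : Expr P p m) (b : Expr P q n) :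
      Rel (.comp g' h (.act α a) (.act β b)) (.act υ (.comp g h a b))
  | one_comp {c : Ξ} {q r : Corolla Ξ} {n : ℤ} (g : Graft (Corolla.unit c) q r)
      (σ : Relabel q r) (H : ∀ j, g.e (some (σ.e j)) = Sum.inr j) (b : Expr P q n) :
      Rel (.comp g (Int.zero_add n) (.one c) b) (.act σ b)
  | comp_one {c : Ξ} {p r : Corolla Ξ} {n : ℤ} (g : Graft p (Corolla.unit c) r)
      (σ : Relabel p r)
      (H : ∀ j, g.e (some (σ.e j)) = if j = g.edge then Sum.inr (0 : Fin 1) else Sum.inl j)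
      (a : Expr P p n) :
      Rel (.comp g (Int.add_zero n) a (.one c)) (.act σ a)
  | comp_seq {p q s r t u : Corolla Ξ} {m n l i j d : ℤ} (g₁ : Graft p q r) (g₂ : Graft r s t)
      (h₁ : Graft q s u) (h₂ : Graft p u t) (H : SeqTree g₁ g₂ h₁ h₂)
      (ha : m + n = i) (hc : i + l = d) (hb : n + l = j) (hc' : m + j = d)
      (a : Expr P p m) (b : Expr P q n) (c : Expr P s l) :
      Rel (.comp g₂ hc (.comp g₁ ha a b) c) (.comp h₂ hc' a (.comp h₁ hb b c))
  | comp_par {p q s r t u : Corolla Ξ} {m n l i j d : ℤ} (g₁ : Graft p q r) (g₂ : Graft r s t)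
      (h₁ : Graft p s u) (h₂ : Graft u q t) (H : ParTree g₁ g₂ h₁ h₂)
      (ha : m + n = i) (hc : i + l = d) (hb : m + l = j) (hc' : j + n = d)
      (a : Expr P p m) (b : Expr P q n) (c : Expr P s l) :
      Rel (.comp g₂ hc (.comp g₁ ha a b) c)
        (.smul (((n * l).negOnePow : ℤ) : k) (.comp h₂ hc' (.comp h₁ hb a c) b))

/-- The components of the free graded operad generated by the suspension of `P`. -/
def Free {k : Type u} [Field k] {Ξ : Type v} (P : DGCollection.{u, v, w} k Ξ) (r : Corolla Ξ)
    (n : ℤ) : Type (max u v w) :=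
  Quot (Expr.Rel (P := P) (r := r) (n := n))

namespace Free

variable {k : Type u} [Field k] {Ξ : Type v} {P : DGCollection.{u, v, w} k Ξ}

/-- The class of an expression. -/
def mk {r : Corolla Ξ} {n : ℤ} (a : Expr P r n) : Free P r n := Quot.mk _ a

instance {r : Corolla Ξ} {n : ℤ} : Zero (Free P r n) := ⟨mk .zero⟩

instance {r : Corolla Ξ} {n : ℤ} : Add (Free P r n) :=
  ⟨Quot.map₂ .add (fun _ _ _ h => .add_congr (.refl _) h) (fun _ _ _ h => .add_congr h (.refl _))⟩

instance {r : Corolla Ξ} {n : ℤ} : SMul k (Free P r n) :=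
  ⟨fun c => Quot.map (.smul c) fun _ _ h => .smul_congr c h⟩

instance {r : Corolla Ξ} {n : ℤ} : Neg (Free P r n) := ⟨fun a => (-1 : k) • a⟩

theorem add_comm' {r : Corolla Ξ} {n : ℤ} (a b : Free P r n) : a + b = b + a := by
  induction a using Quot.ind
  induction b using Quot.ind
  exact Quot.sound (.add_comm _ _)

theorem zero_add' {r : Corolla Ξ} {n : ℤ} (a : Free P r n) : 0 + a = a := by
  induction a using Quot.ind
  exact Quot.sound (.zero_add _)

theorem neg_add' {r : Corolla Ξ} {n : ℤ} (a : Free P r n) : -a + a = 0 := by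
  induction a using Quot.ind with
  | mk a =>
    have h1 : Expr.Rel (.add (.smul (-1) a) a) (.add (.smul (-1) a) (.smul 1 a)) :=
      .add_congr (.refl _) (.symm (.one_smul a))
    have h2 : Expr.Rel (.smul (-1 + 1 : k) a) .zero := by
      rw [neg_add_cancel]; exact .zero_smul a
    exact Quot.sound (h1.trans ((Expr.Rel.add_smul _ _ _).symm.trans h2))

instance {r : Corolla Ξ} {n : ℤ} : AddCommGroup (Free P r n) where
  add_assoc a b c := by
    induction a using Quot.ind
    induction b using Quot.ind
    induction c using Quot.ind
    exact Quot.sound (.add_assoc _ _ _)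
  zero_add := zero_add'
  add_zero a := (add_comm' _ _).trans (zero_add' a)
  nsmul := nsmulRec
  zsmul := zsmulRec
  neg_add_cancel := neg_add'
  add_comm := add_comm'

instance {r : Corolla Ξ} {n : ℤ} : Module k (Free P r n) where
  one_smul a := by
    induction a using Quot.ind
    exact Quot.sound (.one_smul _)
  mul_smul c c' a := by
    induction a using Quot.ind
    exact Quot.sound (.mul_smul _ _ _)
  smul_zero c := by
    have h : Expr.Rel (P := P) (r := r) (n := n) (.smul c .zero) .zero := by
      refine (Expr.Rel.smul_congr c (.symm (.zero_smul .zero))).trans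
        ((Expr.Rel.mul_smul _ _ _).symm.trans ?_)
      rw [mul_zero]
      exact .zero_smul _
    exact Quot.sound h
  smul_add c a b := by
    induction a using Quot.ind
    induction b using Quot.ind
    exact Quot.sound (.smul_add _ _ _)
  add_smul c c' a := by
    induction a using Quot.ind
    exact Quot.sound (.add_smul _ _ _)
  zero_smul a := by
    induction a using Quot.ind
    exact Quot.sound (.zero_smul _)

/-- The generator `s x`, for `x` of degree `n` and `m = n + 1`. -/
def gen {r : Corolla Ξ} {n m : ℤ} (h : n + 1 = m) : P.X r n →ₗ[k] Free P r m where
  toFun x := mk (.gen h x)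
  map_add' _ _ := Quot.sound (.gen_add _ _ _)
  map_smul' _ _ := Quot.sound (.gen_smul _ _ _)

/-- The units of the free operad. -/
def one (c : Ξ) : Free P (Corolla.unit c) 0 := mk (.one c)

/-- Relabelling in the free operad. -/
def act {p q : Corolla Ξ} {n : ℤ} (σ : Relabel p q) : Free P p n →ₗ[k] Free P q n where
  toFun := Quot.map (.act σ) fun _ _ h => .act_congr σ h
  map_add' a b := by
    induction a using Quot.ind
    induction b using Quot.ind
    exact Quot.sound (.act_add _ _ _)
  map_smul' c a := by
    induction a using Quot.ind
    exact Quot.sound (.act_smul _ _ _)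

/-- Insertion in the free operad. -/
def comp {p q r : Corolla Ξ} {m n l : ℤ} (g : Graft p q r) (h : m + n = l) :
    Free P p m →ₗ[k] Free P q n →ₗ[k] Free P r l :=
  LinearMap.mk₂ k
    (Quot.map₂ (.comp g h) (fun _ _ _ H => .comp_congr g h (.refl _) H)
      (fun _ _ _ H => .comp_congr g h H (.refl _)))
    (fun a b c => by
      induction a using Quot.ind
      induction b using Quot.ind
      induction c using Quot.ind
      exact Quot.sound (.add_comp _ _ _ _ _))
    (fun c a b => by
      induction a using Quot.ind
      induction b using Quot.ind
      exact Quot.sound (.smul_comp _ _ _ _ _))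
    (fun a b c => by
      induction a using Quot.ind
      induction b using Quot.ind
      induction c using Quot.ind
      exact Quot.sound (.comp_add _ _ _ _ _))
    (fun c a b => by
      induction a using Quot.ind
      induction b using Quot.ind
      exact Quot.sound (.comp_smul _ _ _ _ _))

theorem gen_act {p q : Corolla Ξ} {n m : ℤ} (h : n + 1 = m) (σ : Relabel p q) (x : P.X p n) :
    gen h (P.act σ x) = act σ (gen h x) := Quot.sound (.gen_act _ _ _)

theorem act_refl {p : Corolla Ξ} {n : ℤ} (a : Free P p n) : act (Relabel.refl p) a = a := by
  induction a using Quot.ind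
  exact Quot.sound (.act_refl _)

theorem act_trans {p q r : Corolla Ξ} {n : ℤ} (σ : Relabel p q) (τ : Relabel q r)
    (a : Free P p n) : act (σ.trans τ) a = act τ (act σ a) := by
  induction a using Quot.ind
  exact Quot.sound (.act_trans _ _ _)

theorem comp_act {p q r p' q' r' : Corolla Ξ} {m n l : ℤ} (g : Graft p q r)
    (g' : Graft p' q' r') (α : Relabel p p') (β : Relabel q q') (υ : Relabel r r')
    (H : g.IsIso g' α β υ) (h : m + n = l) (a : Free P p m) (b : Free P q n) :
    comp g' h (act α a) (act β b) = act υ (comp g h a b) := by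
  induction a using Quot.ind
  induction b using Quot.ind
  exact Quot.sound (.comp_act _ _ _ _ _ H _ _ _)

theorem one_comp {c : Ξ} {q r : Corolla Ξ} {n : ℤ} (g : Graft (Corolla.unit c) q r)
    (σ : Relabel q r) (H : ∀ j, g.e (some (σ.e j)) = Sum.inr j) (b : Free P q n) :
    comp g (Int.zero_add n) (one c) b = act σ b := by
  induction b using Quot.ind
  exact Quot.sound (.one_comp _ _ H _)

theorem comp_one {c : Ξ} {p r : Corolla Ξ} {n : ℤ} (g : Graft p (Corolla.unit c) r)
    (σ : Relabel p r)
    (H : ∀ j, g.e (some (σ.e j)) = if j = g.edge then Sum.inr (0 : Fin 1) else Sum.inl j)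
    (a : Free P p n) : comp g (Int.add_zero n) a (one c) = act σ a := by
  induction a using Quot.ind
  exact Quot.sound (.comp_one _ _ H _)

theorem comp_seq {p q s r t u : Corolla Ξ} {m n l i j d : ℤ} (g₁ : Graft p q r)
    (g₂ : Graft r s t) (h₁ : Graft q s u) (h₂ : Graft p u t) (H : SeqTree g₁ g₂ h₁ h₂)
    (ha : m + n = i) (hc : i + l = d) (hb : n + l = j) (hc' : m + j = d)
    (a : Free P p m) (b : Free P q n) (c : Free P s l) :
    comp g₂ hc (comp g₁ ha a b) c = comp h₂ hc' a (comp h₁ hb b c) := by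
  induction a using Quot.ind
  induction b using Quot.ind
  induction c using Quot.ind
  exact Quot.sound (.comp_seq _ _ _ _ H _ _ _ _ _ _ _)

theorem sign_smul {V : Type w} [AddCommGroup V] [Module k V] (n : ℤ) (x : V) :
    ((n.negOnePow : ℤ) : k) • x = n.negOnePow • x := by
  rw [Int.cast_smul_eq_zsmul, Units.smul_def]

theorem comp_par {p q s r t u : Corolla Ξ} {m n l i j d : ℤ} (g₁ : Graft p q r)
    (g₂ : Graft r s t) (h₁ : Graft p s u) (h₂ : Graft u q t) (H : ParTree g₁ g₂ h₁ h₂)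
    (ha : m + n = i) (hc : i + l = d) (hb : m + l = j) (hc' : j + n = d)
    (a : Free P p m) (b : Free P q n) (c : Free P s l) :
    comp g₂ hc (comp g₁ ha a b) c =
      (n * l).negOnePow • comp h₂ hc' (comp h₁ hb a c) b := by
  rw [← sign_smul (k := k)]
  induction a using Quot.ind
  induction b using Quot.ind
  induction c using Quot.ind
  exact Quot.sound (.comp_par _ _ _ _ H _ _ _ _ _ _ _)

/-- A property of the elements of the free operad holds if it holds for the generators and is
preserved by all operations. -/
theorem induct {C : ∀ {r : Corolla Ξ} {n : ℤ}, Free P r n → Prop}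
    (hgen : ∀ {r : Corolla Ξ} {n m : ℤ} (h : n + 1 = m) (x : P.X r n), C (gen h x))
    (hone : ∀ c, C (one c))
    (hact : ∀ {p q : Corolla Ξ} {n : ℤ} (σ : Relabel p q) (a : Free P p n), C a → C (act σ a))
    (hcomp : ∀ {p q r : Corolla Ξ} {m n l : ℤ} (g : Graft p q r) (h : m + n = l)
      (a : Free P p m) (b : Free P q n), C a → C b → C (comp g h a b))
    (hzero : ∀ {r : Corolla Ξ} {n : ℤ}, C (0 : Free P r n))
    (hadd : ∀ {r : Corolla Ξ} {n : ℤ} (a b : Free P r n), C a → C b → C (a + b))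
    (hsmul : ∀ {r : Corolla Ξ} {n : ℤ} (c : k) (a : Free P r n), C a → C (c • a))
    {r : Corolla Ξ} {n : ℤ} (a : Free P r n) : C a := by
  induction a using Quot.ind with
  | mk a =>
    induction a with
    | gen h x => exact hgen h x
    | one c => exact hone c
    | act σ a ih => exact hact σ _ ih
    | comp g h a b iha ihb => exact hcomp g h _ _ iha ihb
    | zero => exact hzero
    | add a b iha ihb => exact hadd _ _ iha ihb
    | smul c a ih => exact hsmul c _ ih

/-- The value on expressions of the derivation of degree `1` of the free operad that is given by
`δ` on the generators. -/
def derivExpr (δ : ∀ {r : Corolla Ξ} {n m : ℤ}, n + 2 = m → (P.X r n →ₗ[k] Free P r m)) :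
    ∀ {r : Corolla Ξ} {m : ℤ}, Expr P r m → ∀ {m' : ℤ}, m + 1 = m' → Free P r m'
  | _, _, .gen h x, _, h' => δ (by omega) x
  | _, _, .one _, _, _ => 0
  | _, _, .act σ a, _, h' => act σ (derivExpr δ a h')
  | _, _, @Expr.comp _ _ _ _ _ _ _ m _ _ g h a b, _, h' =>
      comp g (by omega) (derivExpr δ a rfl) (mk b) +
        m.negOnePow • comp g (by omega) (mk a) (derivExpr δ b rfl)
  | _, _, .zero, _, _ => 0
  | _, _, .add a b, _, h' => derivExpr δ a h' + derivExpr δ b h'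
  | _, _, .smul c a, _, h' => c • derivExpr δ a h'

theorem derivExpr_sound
    (δ : ∀ {r : Corolla Ξ} {n m : ℤ}, n + 2 = m → (P.X r n →ₗ[k] Free P r m))
    (hδ : ∀ {p q : Corolla Ξ} {n m : ℤ} (h : n + 2 = m) (σ : Relabel p q) (x : P.X p n),
      δ h (P.act σ x) = act σ (δ h x))
    {r : Corolla Ξ} {m : ℤ} {a b : Expr P r m} (H : Expr.Rel a b) :
    ∀ {m' : ℤ} (h' : m + 1 = m'), derivExpr δ a h' = derivExpr δ b h' := by
  induction H with
  | refl a => intros; rfl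
  | symm _ ih => exact fun h' => (ih h').symm
  | trans _ _ ih ih' => exact fun h' => (ih h').trans (ih' h')
  | act_congr σ _ ih => exact fun h' => congrArg (act σ) (ih h')
  | comp_congr g h H H' ih ih' =>
    intro m' h'
    simp only [derivExpr, ih, ih']
    rw [show mk _ = mk _ from Quot.sound H, show mk _ = mk _ from Quot.sound H']
  | add_congr _ _ ih ih' => intro m' h'; simp only [derivExpr, ih, ih']
  | smul_congr c _ ih => intro m' h'; simp only [derivExpr, ih]
  | add_comm a b => intro m' h'; simp only [derivExpr]; exact _root_.add_comm _ _
  | add_assoc a b c => intro m' h'; simp only [derivExpr]; exact _root_.add_assoc _ _ _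
  | zero_add a => intro m' h'; simp only [derivExpr]; exact _root_.zero_add _
  | one_smul a => intro m' h'; simp only [derivExpr]; exact _root_.one_smul _ _
  | zero_smul a => intro m' h'; simp only [derivExpr]; exact _root_.zero_smul _ _
  | mul_smul c c' a => intro m' h'; simp only [derivExpr]; exact (smul_smul _ _ _).symm
  | add_smul c c' a => intro m' h'; simp only [derivExpr]; exact _root_.add_smul _ _ _
  | smul_add c a b => intro m' h'; simp only [derivExpr]; exact _root_.smul_add _ _ _
  | gen_add h x y => intro m' h'; simp only [derivExpr]; exact map_add _ _ _
  | gen_smul h c x => intro m' h'; simp only [derivExpr]; exact map_smul _ _ _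
  | gen_act h σ x => intro m' h'; simp only [derivExpr]; exact hδ _ _ _
  | act_add σ a b => intro m' h'; simp only [derivExpr]; exact map_add _ _ _
  | act_smul σ c a => intro m' h'; simp only [derivExpr]; exact map_smul _ _ _
  | act_refl a => intro m' h'; simp only [derivExpr]; exact act_refl _
  | act_trans σ τ a => intro m' h'; simp only [derivExpr]; exact act_trans _ _ _
  | add_comp g h a a' b =>
    intro m' h'
    simp only [derivExpr]
    rw [show mk (.add a a') = mk a + mk a' from rfl]
    simp only [map_add, LinearMap.add_apply, _root_.smul_add]
    abel
  | smul_comp g h c a b =>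
    intro m' h'
    simp only [derivExpr]
    rw [show mk (.smul c a) = c • mk a from rfl]
    simp only [map_smul, LinearMap.smul_apply, _root_.smul_add]
    rw [smul_comm]
  | comp_add g h a b b' =>
    intro m' h'
    simp only [derivExpr]
    rw [show mk (.add b b') = mk b + mk b' from rfl]
    simp only [map_add, _root_.smul_add]
    abel
  | comp_smul g h c a b =>
    intro m' h'
    simp only [derivExpr]
    rw [show mk (.smul c b) = c • mk b from rfl]
    simp only [map_smul, _root_.smul_add]
    rw [smul_comm]
  | comp_act g g' α β υ H h a b =>
    intro m' h'
    simp only [derivExpr]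
    rw [show mk (.act α a) = act α (mk a) from rfl, show mk (.act β b) = act β (mk b) from rfl,
      comp_act g g' α β υ H, comp_act g g' α β υ H]
    simp only [map_add, Units.smul_def, map_zsmul]
  | one_comp g σ H b =>
    intro m' h'
    subst h'
    simp only [derivExpr]
    rw [show mk (.one _) = one _ from rfl, one_comp g σ H]
    simp
  | comp_one g σ H b =>
    intro m' h'
    subst h'
    simp only [derivExpr]
    rw [show mk (.one _) = one _ from rfl, comp_one g σ H]
    simp
  | comp_seq g₁ g₂ h₁ h₂ H ha hc hb hc' a b c =>
    rename_i m n l i j d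
    intro m' h'
    subst h' ha hb hc
    simp only [derivExpr]
    rw [show mk (.comp g₁ _ a b) = comp g₁ _ (mk a) (mk b) from rfl,
      show mk (.comp h₁ _ b c) = comp h₁ _ (mk b) (mk c) from rfl]
    simp only [map_add, LinearMap.add_apply, Units.smul_def, map_zsmul, LinearMap.smul_apply,
      _root_.smul_add]
    simp only [← Units.smul_def]
    rw [comp_seq g₁ g₂ h₁ h₂ H _ _ rfl (by omega), comp_seq g₁ g₂ h₁ h₂ H _ _
        (by omega : n + 1 + l = n + l + 1) (by omega),
      comp_seq g₁ g₂ h₁ h₂ H _ _ (by omega : n + (l + 1) = n + l + 1) (by omega), smul_smul, ← Int.negOnePow_add]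
    exact _root_.add_assoc _ _ _
  | comp_par g₁ g₂ h₁ h₂ H ha hc hb hc' a b c =>
    rename_i m n l i j d
    intro m' h'
    subst h' ha hb hc
    simp only [derivExpr, sign_smul]
    rw [show mk (.comp g₁ _ a b) = comp g₁ _ (mk a) (mk b) from rfl,
      show mk (.comp h₁ _ a c) = comp h₁ _ (mk a) (mk c) from rfl]
    simp only [map_add, LinearMap.add_apply, Units.smul_def, map_zsmul, LinearMap.smul_apply,
      _root_.smul_add]
    simp only [← Units.smul_def]
    rw [comp_par g₁ g₂ h₁ h₂ H _ _ (by omega : m + 1 + l = m + l + 1) (by omega),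
      comp_par g₁ g₂ h₁ h₂ H _ _ rfl (by omega),
      comp_par g₁ g₂ h₁ h₂ H _ _ (by omega : m + (l + 1) = m + l + 1) (by omega)]
    simp only [smul_smul, ← Int.negOnePow_add]
    have e1 : (m + n + n * (l + 1)).negOnePow = (n * l + m).negOnePow := by
      rw [show m + n + n * (l + 1) = n * l + m + 2 * n by ring,
        Int.negOnePow_add _ (2 * n), Int.negOnePow_two_mul, mul_one]
    have e2 : (m + (n + 1) * l).negOnePow = (n * l + (m + l)).negOnePow := by
      rw [show m + (n + 1) * l = n * l + (m + l) by ring]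
    rw [e1, e2]
    exact add_right_comm _ _ _

/-- The derivation of degree `1` of the free operad that is given by `δ` on the generators. -/
def deriv (δ : ∀ {r : Corolla Ξ} {n m : ℤ}, n + 2 = m → (P.X r n →ₗ[k] Free P r m))
    (hδ : ∀ {p q : Corolla Ξ} {n m : ℤ} (h : n + 2 = m) (σ : Relabel p q) (x : P.X p n),
      δ h (P.act σ x) = act σ (δ h x))
    {r : Corolla Ξ} {m m' : ℤ} (h' : m + 1 = m') : Free P r m →ₗ[k] Free P r m' where
  toFun := Quot.lift (fun a => derivExpr δ a h') fun _ _ H => derivExpr_sound δ hδ H h'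
  map_add' a b := by
    induction a using Quot.ind
    induction b using Quot.ind
    rfl
  map_smul' c a := by
    induction a using Quot.ind
    rfl

end Free

/-! ### Isomorphism classes of trees with two vertices -/

section Cuts

variable {Ξ : Type v}

/-- The lower vertex of the tree `cutGraft r K c`. -/
def cutLower (r : Corolla Ξ) (K : Finset (Fin r.n)) (c : Ξ) : Corolla Ξ :=
  ⟨Kᶜ.card + 1, Fin.cons c fun j => r.inp (Kᶜ.orderEmbOfFin rfl j), r.out⟩

/-- The upper vertex of the tree `cutGraft r K c`. -/
def cutUpper (r : Corolla Ξ) (K : Finset (Fin r.n)) (c : Ξ) : Corolla Ξ :=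
  ⟨K.card, fun j => r.inp (K.orderEmbOfFin rfl j), c⟩

/-- The bijection underlying `cutGraft`. -/
def cutEquiv {n : ℕ} (K : Finset (Fin n)) : Option (Fin n) ≃ Fin (Kᶜ.card + 1) ⊕ Fin K.card :=
  (Equiv.optionCongr (finSumEquivOfFinset (s := K) rfl rfl).symm).trans
    { toFun := fun x => x.elim (Sum.inl 0) (Sum.elim Sum.inr fun j => Sum.inl j.succ)
      invFun := Sum.elim (fun j => Fin.cases none (fun j => some (Sum.inr j)) j)
        fun j => some (Sum.inl j)
      left_inv := by rintro (_ | _ | _) <;> rfl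
      right_inv := by
        rintro (j | j)
        · induction j using Fin.cases <;> rfl
        · rfl }

theorem cutEquiv_some {n : ℕ} (K : Finset (Fin n)) (y : Fin K.card ⊕ Fin Kᶜ.card) :
    cutEquiv K (some (finSumEquivOfFinset rfl rfl y)) =
      Sum.elim Sum.inr (fun j => Sum.inl j.succ) y := by
  have : Equiv.optionCongr (finSumEquivOfFinset (s := K) rfl rfl).symm
      (some (finSumEquivOfFinset rfl rfl y)) = some y :=
    congrArg some (Equiv.symm_apply_apply _ _)
  rw [cutEquiv, Equiv.trans_apply, this]
  rfl

/-- The tree with two vertices and with leaves labelled by the incoming edges of `r`, for which the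
leaves of the upper vertex are those in `K` and the internal edge has color `c`. Every tree with
two vertices and with leaves labelled by the incoming edges of `r` is isomorphic to exactly one of
these. -/
def cutGraft (r : Corolla Ξ) (K : Finset (Fin r.n)) (c : Ξ) :
    Graft (cutLower r K c) (cutUpper r K c) r where
  e := cutEquiv K
  edge := (0 : Fin (Kᶜ.card + 1))
  e_none := rfl
  edge_color := rfl
  leaf_color := by
    intro j
    obtain ⟨y, rfl⟩ := (finSumEquivOfFinset (s := K) rfl rfl).surjective j
    refine (congrArg (Sum.elim (Fin.cons c fun j => r.inp (Kᶜ.orderEmbOfFin rfl j))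
      fun j => r.inp (K.orderEmbOfFin rfl j)) (cutEquiv_some K y)).trans ?_
    rcases y with y | y <;> simp
  out_color := rfl

theorem cutGraft_isRight (r : Corolla Ξ) (K : Finset (Fin r.n)) (c : Ξ) (j : Fin r.n) :
    ((cutGraft r K c).e (some j)).isRight ↔ j ∈ K := by
  obtain ⟨y, rfl⟩ := (finSumEquivOfFinset (s := K) rfl rfl).surjective j
  rw [show ((cutGraft r K c).e _).isRight = _ from congrArg Sum.isRight (cutEquiv_some K y)]
  rcases y with y | y
  · exact iff_of_true rfl (by simp)
  · exact iff_of_false Bool.false_ne_true (by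
      have := Finset.orderEmbOfFin_mem Kᶜ rfl y
      rw [Finset.mem_compl] at this
      simpa using this)

theorem cutGraft_injective (r : Corolla Ξ) : Function.Injective
    (fun t : Finset (Fin r.n) × Ξ =>
      (⟨_, _, cutGraft r t.1 t.2⟩ : Σ p q : Corolla Ξ, Graft p q r)) := by
  intro t t' h
  have h1 := congrArg (fun g : Σ p q : Corolla Ξ, Graft p q r => g.2.1.out) h
  have h2 : ∀ j, ((cutGraft r t.1 t.2).e (some j)).isRight =
      ((cutGraft r t'.1 t'.2).e (some j)).isRight := fun j =>
    congrArg (fun g : Σ p q : Corolla Ξ, Graft p q r => (g.2.2.e (some j)).isRight) h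
  refine Prod.ext (Finset.ext fun j => ?_) h1
  rw [← cutGraft_isRight r t.1 t.2, ← cutGraft_isRight r t'.1 t'.2, h2]

/-- A bijection of disjoint unions that respects the summands is a union of bijections. -/
theorem exists_sum_map {A B A' B' : Type} (f : A ⊕ B ≃ A' ⊕ B')
    (hf : ∀ x, (f x).isRight = x.isRight) :
    ∃ (α : A ≃ A') (β : B ≃ B'), ∀ x, f x = Sum.map α β x := by
  have h1 : ∀ a, ∃ a', f (Sum.inl a) = Sum.inl a' := fun a => by
    have := hf (Sum.inl a)
    rcases h : f (Sum.inl a) with y | y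
    · exact ⟨y, rfl⟩
    · simp [h] at this
  have h2 : ∀ b, ∃ b', f (Sum.inr b) = Sum.inr b' := fun b => by
    have := hf (Sum.inr b)
    rcases h : f (Sum.inr b) with y | y
    · simp [h] at this
    · exact ⟨y, rfl⟩
  choose α hα using h1
  choose β hβ using h2
  have hbij : Function.Bijective (Sum.map α β) := by
    have : f = Sum.map α β := by
      funext x; rcases x with x | x <;> simp [hα, hβ]
    rw [← this]; exact f.bijective
  have hb := Sum.map_bijective.1 hbij
  exact ⟨Equiv.ofBijective α hb.1, Equiv.ofBijective β hb.2,
    fun x => by rcases x with x | x <;> simp [hα, hβ]⟩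

/-- Trees with two vertices are isomorphic if they have the same leaves at the upper vertex and
the same color of the internal edge. -/
theorem Graft.exists_iso {p q r p' q' r' : Corolla Ξ} (g : Graft p q r) (g' : Graft p' q' r')
    (υ : Relabel r r') (hc : q'.out = q.out)
    (hk : ∀ j, (g'.e (some (υ.e j))).isRight = (g.e (some j)).isRight) :
    ∃ (α : Relabel p p') (β : Relabel q q'), g.IsIso g' α β υ := by
  have hcol : ∀ x, Sum.elim p'.inp q'.inp (g'.e (Option.map υ.e x)) =
      Sum.elim p.inp q.inp (g.e x) := by
    rintro (_ | x)
    · simp [Graft.e_none, Graft.edge_color, hc]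
    · simp [Graft.leaf_color, υ.inp]
  obtain ⟨α, β, H⟩ := exists_sum_map ((g.e.symm.trans (Equiv.optionCongr υ.e)).trans g'.e) (by
    intro x
    obtain ⟨y, rfl⟩ := g.e.surjective x
    rcases y with _ | y
    · rw [Equiv.trans_apply, Equiv.trans_apply, Equiv.symm_apply_apply]
      simp [Graft.e_none]
    · simpa using hk y)
  have H' : ∀ x, g'.e (Option.map υ.e x) = Sum.map α β (g.e x) := fun x => by
    rw [← H]; simp
  refine ⟨⟨α, fun j => ?_, ?_⟩, ⟨β, fun j => ?_, hc⟩, H'⟩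
  · obtain ⟨y, hy⟩ := g.e.surjective (Sum.inl j)
    have h1 := hcol y
    rw [H', hy] at h1
    exact h1
  · rw [g'.out_color, g.out_color, υ.out]
  · obtain ⟨y, hy⟩ := g.e.surjective (Sum.inr j)
    have h1 := hcol y
    rw [H', hy] at h1
    exact h1

/-! ### Trees with three vertices -/

/-- The incoming edges of the vertices of the tree that is obtained by inserting `g₁` into the
lower vertex of `g₂`, in terms of its leaves and its two internal edges. -/
def lowE {p q r s t : Corolla Ξ} (g₁ : Graft p q r) (g₂ : Graft r s t) :
    Option (Option (Fin t.n)) ≃ Fin p.n ⊕ (Fin q.n ⊕ Fin s.n) where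
  toFun x := x.elim (Sum.inl g₁.edge) fun y =>
    Sum.elim (fun y => Sum.map id Sum.inl (g₁.e (some y))) (fun z => Sum.inr (Sum.inr z)) (g₂.e y)
  invFun := Sum.elim (fun a => (g₁.e.symm (Sum.inl a)).map fun y => g₂.e.symm (Sum.inl y))
    (Sum.elim (fun b => (g₁.e.symm (Sum.inr b)).map fun y => g₂.e.symm (Sum.inl y))
      fun c => some (g₂.e.symm (Sum.inr c)))
  left_inv := by
    rintro (_ | y)
    · simp [← g₁.e_none]
    · obtain ⟨y, rfl⟩ := g₂.e.symm.surjective y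
      rcases y with y | y
      · rcases h : g₁.e (some y) with z | z <;> simp [h] <;> simp [← h]
      · simp
  right_inv := by
    rintro (a | b | c)
    · rcases h : g₁.e.symm (Sum.inl a) with _ | y
      · rw [Equiv.symm_apply_eq, g₁.e_none] at h
        simp only [Sum.inl.injEq] at h
        simp [h, ← g₁.e_none]
      · have h' := h
        rw [Equiv.symm_apply_eq] at h'
        simp [h, ← h']
    · rcases h : g₁.e.symm (Sum.inr b) with _ | y
      · rw [Equiv.symm_apply_eq, g₁.e_none] at h
        simp at h
      · have h' := h
        rw [Equiv.symm_apply_eq] at h'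
        simp [h, ← h']
    · simp

/-- The incoming edges of the vertices of the tree that is obtained by inserting `h₁` into the
upper vertex of `h₂`, in terms of its leaves and its two internal edges. -/
def uppE {p q s t u : Corolla Ξ} (h₁ : Graft q s u) (h₂ : Graft p u t) :
    Option (Option (Fin t.n)) ≃ Fin p.n ⊕ (Fin q.n ⊕ Fin s.n) where
  toFun x := x.elim (Sum.inr (Sum.inl h₁.edge)) fun y =>
    Sum.map id (fun y => h₁.e (some y)) (h₂.e y)
  invFun := Sum.elim (fun a => some (h₂.e.symm (Sum.inl a)))
    (fun b => (h₁.e.symm b).map fun y => h₂.e.symm (Sum.inr y))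
  left_inv := by
    rintro (_ | y)
    · simp [← h₁.e_none]
    · obtain ⟨y, rfl⟩ := h₂.e.symm.surjective y
      rcases y with y | y <;> simp
  right_inv := by
    rintro (a | b)
    · simp
    · obtain ⟨y, rfl⟩ := h₁.e.surjective b
      rw [Sum.elim_inr, Equiv.symm_apply_apply]
      rcases y with _ | y <;> simp [h₁.e_none]

/-- The vertex (`0`, `1` or `2`) to which an incoming edge belongs. -/
def vertexOf {A B C : Type} : A ⊕ (B ⊕ C) → Fin 3 :=
  Sum.elim (fun _ => 0) (Sum.elim (fun _ => 1) fun _ => 2)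

theorem lowE_color {p q r s t : Corolla Ξ} (g₁ : Graft p q r) (g₂ : Graft r s t)
    (x : Option (Option (Fin t.n))) :
    Sum.elim p.inp (Sum.elim q.inp s.inp) (lowE g₁ g₂ x) =
      x.elim q.out fun y => y.elim s.out t.inp := by
  have key : ∀ y, Sum.elim p.inp (Sum.elim q.inp s.inp) (lowE g₁ g₂ (some y)) =
      Sum.elim r.inp s.inp (g₂.e y) := by
    intro y
    rcases h : g₂.e y with z | z
    · have := g₁.leaf_color z
      rcases h' : g₁.e (some z) with a | a <;> simpa [lowE, h, h'] using this
    · simp [lowE, h]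
  rcases x with _ | _ | x
  · simpa [lowE] using g₁.edge_color
  · rw [key, g₂.e_none]; simpa using g₂.edge_color
  · rw [key, g₂.leaf_color]; rfl

theorem uppE_color {p q s t u : Corolla Ξ} (h₁ : Graft q s u) (h₂ : Graft p u t)
    (x : Option (Option (Fin t.n))) :
    Sum.elim p.inp (Sum.elim q.inp s.inp) (uppE h₁ h₂ x) =
      x.elim s.out fun y => y.elim q.out t.inp := by
  have key : ∀ y, Sum.elim p.inp (Sum.elim q.inp s.inp) (uppE h₁ h₂ (some y)) =
      Sum.elim p.inp u.inp (h₂.e y) := by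
    intro y
    rcases h : h₂.e y with z | z
    · simp [uppE, h]
    · simpa [uppE, h] using h₁.leaf_color z
  rcases x with _ | _ | x
  · simpa [uppE] using h₁.edge_color
  · rw [key, h₂.e_none]; simpa [h₁.out_color] using h₂.edge_color
  · rw [key, h₂.leaf_color]; rfl

/-- Exchange of the two internal edges. -/
def swapEdges (A : Type) : Option (Option A) ≃ Option (Option A) where
  toFun x := x.elim (some none) fun y => y.elim none fun z => some (some z)
  invFun x := x.elim (some none) fun y => y.elim none fun z => some (some z)
  left_inv := by rintro (_ | _ | _) <;> rfl
  right_inv := by rintro (_ | _ | _) <;> rfl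

/-- Bijections between the incoming edges of two trees with three vertices, which respect the
vertices and the colors, consist of relabellings of the vertices. -/
theorem exists_relabel {p q s p' q' s' : Corolla Ξ}
    (f : Fin p.n ⊕ (Fin q.n ⊕ Fin s.n) ≃ Fin p'.n ⊕ (Fin q'.n ⊕ Fin s'.n))
    (hv : ∀ x, vertexOf (f x) = vertexOf x)
    (hc : ∀ x, Sum.elim p'.inp (Sum.elim q'.inp s'.inp) (f x) =
      Sum.elim p.inp (Sum.elim q.inp s.inp) x)
    (hp : p'.out = p.out) (hq : q'.out = q.out) (hs : s'.out = s.out) :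
    ∃ (α : Relabel p p') (β : Relabel q q') (γ : Relabel s s'),
      ∀ x, f x = Sum.map α.e (Sum.map β.e γ.e) x := by
  obtain ⟨α, f', H⟩ := exists_sum_map f (by
    intro x
    have := hv x
    rcases h : f x with a | a | a <;> rcases x with x | x | x <;>
      simp [h, vertexOf] at this ⊢)
  obtain ⟨β, γ, H'⟩ := exists_sum_map f' (by
    intro x
    have := hv (Sum.inr x)
    rw [H] at this
    rcases h : f' x with a | a <;> rcases x with x | x <;>
      simp [h, vertexOf] at this ⊢)
  have K : ∀ x, f x = Sum.map α (Sum.map β γ) x := by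
    intro x
    rw [H]
    rcases x with x | x
    · rfl
    · simp [H']
  refine ⟨⟨α, fun j => ?_, hp⟩, ⟨β, fun j => ?_, hq⟩, ⟨γ, fun j => ?_, hs⟩, K⟩
  · simpa [K] using hc (Sum.inl j)
  · simpa [K] using hc (Sum.inr (Sum.inl j))
  · simpa [K] using hc (Sum.inr (Sum.inr j))

/-- Relabelling of the vertices of a tree with two vertices. -/
def Graft.map {p q r p' q' : Corolla Ξ} (g : Graft p q r) (α : Relabel p p') (β : Relabel q q') :
    Graft p' q' r where
  e := g.e.trans (Equiv.sumCongr α.e β.e)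
  edge := α.e g.edge
  e_none := by simp [g.e_none]
  edge_color := by rw [α.inp, g.edge_color, β.out]
  leaf_color j := by
    rw [← g.leaf_color j]
    rcases h : g.e (some j) with a | a <;> simp [h, α.inp, β.inp]
  out_color := by rw [α.out, g.out_color]

theorem Graft.map_isIso {p q r p' q' : Corolla Ξ} (g : Graft p q r) (α : Relabel p p')
    (β : Relabel q q') : g.IsIso (g.map α β) α β (Relabel.refl r) := by
  intro x
  rcases x with _ | x <;> simp [Relabel.refl, Graft.map]

theorem exists_seqTree {p q s p' q' s' r t u : Corolla Ξ} (g₁ : Graft p q r) (g₂ : Graft r s t)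
    (h₁ : Graft q' s' u) (h₂ : Graft p' u t) (hq : q'.out = q.out) (hs : s'.out = s.out)
    (hv : ∀ x, vertexOf (uppE h₁ h₂ (swapEdges _ x)) = vertexOf (lowE g₁ g₂ x)) :
    ∃ (α : Relabel p p') (β : Relabel q q') (γ : Relabel s s'),
      SeqTree (g₁.map α β) (g₂.map (Relabel.refl r) γ) h₁ h₂ := by
  obtain ⟨α, β, γ, H⟩ := exists_relabel
    (((lowE g₁ g₂).symm.trans (swapEdges _)).trans (uppE h₁ h₂))
    (fun x => by
      obtain ⟨y, rfl⟩ := (lowE g₁ g₂).surjective x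
      simpa using hv y)
    (fun x => by
      obtain ⟨y, rfl⟩ := (lowE g₁ g₂).surjective x
      simp only [Equiv.trans_apply, Equiv.symm_apply_apply, lowE_color, uppE_color]
      rcases y with _ | _ | y <;> simp [swapEdges, hq, hs])
    (by rw [h₂.out_color, g₁.out_color, g₂.out_color]) hq hs
  have K : ∀ x, uppE h₁ h₂ (swapEdges _ x) = Sum.map α.e (Sum.map β.e γ.e) (lowE g₁ g₂ x) :=
    fun x => by rw [← H]; simp
  refine ⟨α, β, γ, ?_, ?_, fun j => ?_⟩
  · have := K none
    simpa [uppE, lowE, swapEdges, h₂.e_none, Graft.map] using this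
  · have := K (some none)
    rcases h : g₁.e (some g₂.edge) with a | a <;>
      simp_all [uppE, lowE, swapEdges, g₂.e_none, Graft.map, Relabel.refl]
  · have := K (some (some j))
    rcases h : g₂.e (some j) with a | a
    · rcases h' : g₁.e (some a) with b | b <;>
      simp_all [uppE, lowE, swapEdges, Graft.map, Relabel.refl]
    · simp_all [uppE, lowE, swapEdges, Graft.map, Relabel.refl]

theorem exists_parTree {p q s p' q' s' r t u : Corolla Ξ} (g₁ : Graft p q r) (g₂ : Graft r s t)
    (h₁ : Graft p' s' u) (h₂ : Graft u q' t) (hq : q'.out = q.out) (hs : s'.out = s.out)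
    (hv : ∀ x, vertexOf (Sum.map id Sum.swap (lowE h₁ h₂ (swapEdges _ x))) =
      vertexOf (lowE g₁ g₂ x)) :
    ∃ (α : Relabel p p') (β : Relabel q q') (γ : Relabel s s'),
      ParTree (g₁.map α β) (g₂.map (Relabel.refl r) γ) h₁ h₂ := by
  obtain ⟨α, β, γ, H⟩ := exists_relabel
    ((((lowE g₁ g₂).symm.trans (swapEdges _)).trans (lowE h₁ h₂)).trans
      (Equiv.sumCongr (Equiv.refl _) (Equiv.sumComm _ _)))
    (fun x => by
      obtain ⟨y, rfl⟩ := (lowE g₁ g₂).surjective x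
      simpa using hv y)
    (fun x => by
      obtain ⟨y, rfl⟩ := (lowE g₁ g₂).surjective x
      have h2 : ∀ z : Fin p'.n ⊕ (Fin s'.n ⊕ Fin q'.n),
          Sum.elim p'.inp (Sum.elim q'.inp s'.inp)
            (Equiv.sumCongr (Equiv.refl _) (Equiv.sumComm _ _) z) =
          Sum.elim p'.inp (Sum.elim s'.inp q'.inp) z := by
        rintro (z | z | z) <;> rfl
      simp only [Equiv.trans_apply, Equiv.symm_apply_apply, h2, lowE_color]
      rcases y with _ | _ | y <;> simp [swapEdges, hq, hs])
    (by rw [h₁.out_color, h₂.out_color, g₁.out_color, g₂.out_color]) hq hs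
  have K : ∀ x, Sum.map id Sum.swap (lowE h₁ h₂ (swapEdges _ x)) =
      Sum.map α.e (Sum.map β.e γ.e) (lowE g₁ g₂ x) :=
    fun x => by rw [← H]; simp
  have K' : ∀ x, lowE h₁ h₂ (swapEdges _ x) =
      Sum.map id Sum.swap (Sum.map α.e (Sum.map β.e γ.e) (lowE g₁ g₂ x)) := fun x => by
    rw [← K]
    rcases lowE h₁ h₂ (swapEdges _ x) with y | y | y <;> rfl
  refine ⟨α, β, γ, ?_, ?_, fun j => ?_⟩
  · have := K' (some none)
    rcases h : g₁.e (some g₂.edge) with a | a <;>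
      simp_all [lowE, swapEdges, g₂.e_none, Graft.map, Relabel.refl]
  · have := K' none
    rcases h : h₁.e (some h₂.edge) with a | a <;>
      simp_all [lowE, swapEdges, h₂.e_none, Graft.map]
  · have := K (some (some j))
    rcases h : g₂.e (some j) with a | a <;> rcases h'' : h₂.e (some j) with c | c
    · rcases h' : g₁.e (some a) with b | b <;> rcases h''' : h₁.e (some c) with d | d <;>
      simp_all [lowE, swapEdges, Graft.map, Relabel.refl]
    · rcases h' : g₁.e (some a) with b | b <;>
      simp_all [lowE, swapEdges, Graft.map, Relabel.refl]
    · rcases h''' : h₁.e (some c) with d | d <;>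
      simp_all [lowE, swapEdges, Graft.map, Relabel.refl]
    · simp_all [lowE, swapEdges]

end Cuts

/-! ### The cobar construction -/

namespace DGPseudoCooperad

variable {k : Type u} [Field k] {Ξ : Type v} (P : DGPseudoCooperad.{u, v, w} k Ξ)

/-- The map `x' ⊗ x'' ↦ (-1) ^ |x'| (s x') ∘ (s x'')`, that is, `s ⊗ s` followed by the insertion
along the tree `g`. -/
def insert {p q r : Corolla Ξ} {i j m : ℤ} (g : Graft p q r) (h : i + j + 2 = m) :
    P.X p i ⊗[k] P.X q j →ₗ[k] Free P.toDGCollection r m :=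
  TensorProduct.lift (i.negOnePow •
    (Free.comp g (by omega : (i + 1) + (j + 1) = m)).compl₁₂ (Free.gen rfl) (Free.gen rfl))

theorem insert_tmul {p q r : Corolla Ξ} {i j m : ℤ} (g : Graft p q r) (h : i + j + 2 = m)
    {i' j' : ℤ} (hi : i + 1 = i') (hj : j + 1 = j') (h' : i' + j' = m)
    (x : P.X p i) (y : P.X q j) :
    P.insert g h (x ⊗ₜ y) = i.negOnePow • Free.comp g h' (Free.gen hi x) (Free.gen hj y) := by
  subst hi hj; rfl

/-- The component of the cobar differential for the tree `g` and the degrees `i` and `n - i`. -/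
def cobarTerm {p q r : Corolla Ξ} {n m : ℤ} (g : Graft p q r) (i : ℤ) (h : n + 2 = m) :
    P.X r n →ₗ[k] Free P.toDGCollection r m :=
  P.insert g (by omega) ∘ₗ P.Δ g (add_sub_cancel i n)

theorem cobarTerm_act {p q r p' q' r' : Corolla Ξ} {n m : ℤ} (g : Graft p q r)
    (g' : Graft p' q' r') (α : Relabel p p') (β : Relabel q q') (υ : Relabel r r')
    (H : g.IsIso g' α β υ) (i : ℤ) (h : n + 2 = m) (x : P.X r n) :
    P.cobarTerm g' i h (P.act υ x) = Free.act υ (P.cobarTerm g i h x) := by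
  simp only [cobarTerm, LinearMap.comp_apply]
  rw [P.Δ_act g g' α β υ H]
  generalize P.Δ g (add_sub_cancel i n) x = y
  induction y using TensorProduct.induction_on with
  | zero => simp
  | tmul a b =>
    rw [TensorProduct.map_tmul, P.insert_tmul _ _ rfl rfl (by omega),
      P.insert_tmul _ _ rfl rfl (by omega), Free.gen_act, Free.gen_act, Free.comp_act g g' α β υ H,
      Units.smul_def, Units.smul_def, map_zsmul]
  | add a b ha hb => simp only [map_add, ha, hb]

theorem finite_cut {r : Corolla Ξ} {n : ℤ} (x : P.X r n) :
    {t : (Finset (Fin r.n) × Ξ) × ℤ |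
      P.Δ (cutGraft r t.1.1 t.1.2) (add_sub_cancel t.2 n) x ≠ 0}.Finite :=
  (P.finite_Δ x).preimage ((cutGraft_injective r).prodMap Function.injective_id).injOn

theorem finite_cobarTerm {r : Corolla Ξ} {n m : ℤ} (h : n + 2 = m) (x : P.X r n) :
    (Function.support fun t : (Finset (Fin r.n) × Ξ) × ℤ =>
      P.cobarTerm (cutGraft r t.1.1 t.1.2) t.2 h x).Finite :=
  (P.finite_cut x).subset fun t ht h0 => ht (by simp [cobarTerm, h0])

/-- The quadratic part of the cobar differential, up to the sign: the sum of `(s ⊗ s) (Δ_g x)` over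
all isomorphism classes of trees `g` with two vertices. -/
noncomputable def cobarQuad {r : Corolla Ξ} {n m : ℤ} (h : n + 2 = m) :
    P.X r n →ₗ[k] Free P.toDGCollection r m where
  toFun x := ∑ᶠ t : (Finset (Fin r.n) × Ξ) × ℤ, P.cobarTerm (cutGraft r t.1.1 t.1.2) t.2 h x
  map_add' x y := by
    simp only [map_add]
    exact finsum_add_distrib (P.finite_cobarTerm h x) (P.finite_cobarTerm h y)
  map_smul' c x := by
    simp only [map_smul, RingHom.id_apply]
    exact (smul_finsum' c (P.finite_cobarTerm h x)).symm

/-- The cobar differential on the generators, `s x ↦ - s (d x) - ∑ (s ⊗ s) (Δ_g x)`. -/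
noncomputable def cobarGen {r : Corolla Ξ} {n m : ℤ} (h : n + 2 = m) :
    P.X r n →ₗ[k] Free P.toDGCollection r m :=
  -(Free.gen (by omega : n + 1 + 1 = m) ∘ₗ P.d (rfl : n + 1 = n + 1)) - P.cobarQuad h

theorem cobarQuad_act {p q : Corolla Ξ} {n m : ℤ} (h : n + 2 = m) (σ : Relabel p q)
    (x : P.X p n) : P.cobarQuad h (P.act σ x) = Free.act σ (P.cobarQuad h x) := by
  change (∑ᶠ t : (Finset (Fin q.n) × Ξ) × ℤ,
    P.cobarTerm (cutGraft q t.1.1 t.1.2) t.2 h (P.act σ x)) = Free.act σ (∑ᶠ t :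
      (Finset (Fin p.n) × Ξ) × ℤ, P.cobarTerm (cutGraft p t.1.1 t.1.2) t.2 h x)
  rw [map_finsum _ (P.finite_cobarTerm h x)]
  symm
  let e : (Finset (Fin p.n) × Ξ) × ℤ ≃ (Finset (Fin q.n) × Ξ) × ℤ :=
    Equiv.prodCongr (Equiv.prodCongr σ.e.finsetCongr (Equiv.refl _)) (Equiv.refl _)
  refine finsum_eq_of_bijective e e.bijective fun t => ?_
  obtain ⟨α, β, H⟩ := (cutGraft p t.1.1 t.1.2).exists_iso
    (cutGraft q (e t).1.1 (e t).1.2) σ rfl (fun j => by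
      rw [Bool.eq_iff_iff, cutGraft_isRight, cutGraft_isRight]
      simp [e])
  exact (P.cobarTerm_act _ _ α β σ H _ h x).symm

theorem cobarGen_act {p q : Corolla Ξ} {n m : ℤ} (h : n + 2 = m) (σ : Relabel p q)
    (x : P.X p n) : P.cobarGen h (P.act σ x) = Free.act σ (P.cobarGen h x) := by
  simp only [cobarGen, LinearMap.sub_apply, LinearMap.neg_apply, LinearMap.comp_apply, map_sub,
    map_neg, cobarQuad_act, ← P.act_d, Free.gen_act]

/-- The cobar differential. -/
noncomputable def cobarD {r : Corolla Ξ} {m n : ℤ} (h : m + 1 = n) :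
    Free P.toDGCollection r m →ₗ[k] Free P.toDGCollection r n :=
  Free.deriv P.cobarGen P.cobarGen_act h

theorem cobarD_gen {r : Corolla Ξ} {n m m' : ℤ} (h : n + 1 = m) (h' : m + 1 = m') (x : P.X r n) :
    P.cobarD h' (Free.gen h x) = P.cobarGen (by omega) x := rfl

theorem cobarD_one (c : Ξ) {m : ℤ} (h : 0 + 1 = m) :
    P.cobarD h (Free.one c) = 0 := rfl

theorem cobarD_act {p q : Corolla Ξ} {m n : ℤ} (h : m + 1 = n) (σ : Relabel p q)
    (x : Free P.toDGCollection p m) :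
    Free.act σ (P.cobarD h x) = P.cobarD h (Free.act σ x) := by
  induction x using Quot.ind; rfl

theorem cobarD_comp {p q r : Corolla Ξ} {m n l m' n' l' : ℤ} (g : Graft p q r) (h : m + n = l)
    (hm : m + 1 = m') (hn : n + 1 = n') (hl : l + 1 = l') (h₁ : m' + n = l') (h₂ : m + n' = l')
    (x : Free P.toDGCollection p m) (y : Free P.toDGCollection q n) :
    P.cobarD hl (Free.comp g h x y) = Free.comp g h₁ (P.cobarD hm x) y +
      m.negOnePow • Free.comp g h₂ x (P.cobarD hn y) := by
  subst hm hn
  induction x using Quot.ind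
  induction y using Quot.ind
  rfl

/-! The square of the cobar differential vanishes. -/

/-- The component of `Δ` for `g₁` at the lower vertex of `g₂`, inserted into the free operad. -/
def lowV {p q r s t : Corolla Ξ} {i₁ i₂ i₃ a n m : ℤ} (g₁ : Graft p q r) (g₂ : Graft r s t)
    (ha : i₁ + i₂ = a) (hn : a + i₃ = n) (hm : n + 3 = m) :
    P.X t n →ₗ[k] Free P.toDGCollection t m :=
  TensorProduct.lift (a.negOnePow • (Free.comp g₂ (by omega : (a + 2) + (i₃ + 1) = m)).compl₁₂
      (P.insert g₁ (by omega)) (Free.gen rfl)) ∘ₗ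
    TensorProduct.map (P.Δ g₁ ha) LinearMap.id ∘ₗ P.Δ g₂ hn

/-- The component of `Δ` for `h₁` at the upper vertex of `h₂`, inserted into the free operad. -/
def uppV {p q s t u : Corolla Ξ} {i₁ i₂ i₃ b n m : ℤ} (h₁ : Graft q s u) (h₂ : Graft p u t)
    (hb : i₂ + i₃ = b) (hn : i₁ + b = n) (hm : n + 3 = m) :
    P.X t n →ₗ[k] Free P.toDGCollection t m :=
  TensorProduct.lift ((Free.comp h₂ (by omega : (i₁ + 1) + (b + 2) = m)).compl₁₂
      (Free.gen rfl) (P.insert h₁ (by omega))) ∘ₗ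
    TensorProduct.map LinearMap.id (P.Δ h₁ hb) ∘ₗ P.Δ h₂ hn

theorem lowV_seq {p q s r t u : Corolla Ξ} {i₁ i₂ i₃ a b n m : ℤ} (g₁ : Graft p q r)
    (g₂ : Graft r s t) (h₁ : Graft q s u) (h₂ : Graft p u t) (H : SeqTree g₁ g₂ h₁ h₂)
    (ha : i₁ + i₂ = a) (hn : a + i₃ = n) (hb : i₂ + i₃ = b) (hn' : i₁ + b = n) (hm : n + 3 = m)
    (x : P.X t n) : P.lowV g₁ g₂ ha hn hm x = P.uppV h₁ h₂ hb hn' hm x := by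
  simp only [lowV, uppV, LinearMap.comp_apply]
  rw [← P.Δ_seq g₁ g₂ h₁ h₂ H ha hn hb hn']
  generalize TensorProduct.map (P.Δ g₁ ha) LinearMap.id (P.Δ g₂ hn x) = y
  induction y using TensorProduct.induction_on with
  | zero => simp
  | add y z hy hz => simp only [map_add, hy, hz]
  | tmul y c =>
    induction y using TensorProduct.induction_on with
    | zero => simp
    | add y z hy hz => simp only [map_add, TensorProduct.add_tmul, hy, hz]
    | tmul x y =>
      rw [TensorProduct.assoc_tmul, TensorProduct.lift.tmul, TensorProduct.lift.tmul,
        LinearMap.smul_apply, LinearMap.smul_apply,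
        LinearMap.compl₁₂_apply, LinearMap.compl₁₂_apply,
        P.insert_tmul g₁ _ rfl rfl (by omega), P.insert_tmul h₁ _ rfl rfl (by omega)]
      simp only [Units.smul_def, map_zsmul, LinearMap.smul_apply]
      simp only [← Units.smul_def]
      rw [Free.comp_seq g₁ g₂ h₁ h₂ H _ _ (by omega : (i₂ + 1) + (i₃ + 1) = b + 2) (by omega),
        smul_smul,
        ← Int.negOnePow_add]
      congr 1
      rw [← ha, show i₁ + i₂ + i₁ = i₂ + 2 * i₁ by ring, Int.negOnePow_add,
        Int.negOnePow_two_mul, mul_one]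

theorem lowV_par {p q s r t u : Corolla Ξ} {i₁ i₂ i₃ a b n m : ℤ} (g₁ : Graft p q r)
    (g₂ : Graft r s t) (h₁ : Graft p s u) (h₂ : Graft u q t) (H : ParTree g₁ g₂ h₁ h₂)
    (ha : i₁ + i₂ = a) (hn : a + i₃ = n) (hb : i₁ + i₃ = b) (hn' : b + i₂ = n) (hm : n + 3 = m)
    (x : P.X t n) : P.lowV g₁ g₂ ha hn hm x = -P.lowV h₁ h₂ hb hn' hm x := by
  simp only [lowV, LinearMap.comp_apply]
  rw [P.Δ_par g₁ g₂ h₁ h₂ H ha hn hb hn']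
  generalize TensorProduct.map (P.Δ h₁ hb) LinearMap.id (P.Δ h₂ hn' x) = y
  induction y using TensorProduct.induction_on with
  | zero => simp
  | add y z hy hz =>
    rw [map_add, Units.smul_def ((i₂ * i₃).negOnePow), zsmul_add, map_add, map_add, neg_add, ← hy,
      ← hz]
    rfl
  | tmul y c =>
    induction y using TensorProduct.induction_on with
    | zero => simp
    | add y z hy hz =>
      rw [TensorProduct.add_tmul, map_add, Units.smul_def ((i₂ * i₃).negOnePow), zsmul_add, map_add,
        map_add, neg_add, ← hy, ← hz]
      rfl
    | tmul x y =>
      rw [TensorProduct.rightComm_tmul]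
      simp only [Units.smul_def, map_zsmul]
      simp only [← Units.smul_def]
      rw [TensorProduct.lift.tmul, TensorProduct.lift.tmul,
        LinearMap.smul_apply, LinearMap.smul_apply, LinearMap.smul_apply, LinearMap.smul_apply,
        LinearMap.compl₁₂_apply, LinearMap.compl₁₂_apply,
        P.insert_tmul g₁ _ rfl rfl (by omega), P.insert_tmul h₁ _ rfl rfl (by omega)]
      simp only [Units.smul_def, map_zsmul, LinearMap.smul_apply]
      simp only [← Units.smul_def]
      rw [Free.comp_par g₁ g₂ h₁ h₂ H _ _ (by omega : (i₁ + 1) + (i₃ + 1) = b + 2) (by omega)]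
      simp only [smul_smul, ← Int.negOnePow_add]
      rw [← Units.neg_smul, ← Int.negOnePow_succ]
      congr 1
      rw [← ha, ← hb, show i₂ * i₃ + (i₁ + i₂ + (i₁ + (i₂ + 1) * (i₃ + 1))) =
        i₁ + i₃ + i₁ + 1 + 2 * (i₂ * i₃ + i₂) by ring, Int.negOnePow_add _ (2 * _),
        Int.negOnePow_two_mul, mul_one]

theorem lowV_map {p q s p' q' s' r t : Corolla Ξ} {i₁ i₂ i₃ a n m : ℤ} (g₁ : Graft p q r)
    (g₂ : Graft r s t) (α : Relabel p p') (β : Relabel q q') (γ : Relabel s s')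
    (ha : i₁ + i₂ = a) (hn : a + i₃ = n) (hm : n + 3 = m) (x : P.X t n) :
    P.lowV (g₁.map α β) (g₂.map (Relabel.refl r) γ) ha hn hm x = P.lowV g₁ g₂ ha hn hm x := by
  have h1 : ∀ y, P.Δ (g₁.map α β) ha y = TensorProduct.map (P.act α) (P.act β) (P.Δ g₁ ha y) :=
    fun y => by
      rw [← P.Δ_act g₁ _ α β _ (g₁.map_isIso α β), P.act_refl]
  have h2 := P.Δ_act g₂ _ (Relabel.refl r) γ _ (g₂.map_isIso _ γ) hn x
  rw [P.act_refl] at h2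
  simp only [lowV, LinearMap.comp_apply]
  rw [h2]
  generalize P.Δ g₂ hn x = y
  induction y using TensorProduct.induction_on with
  | zero => simp
  | add y z hy hz => simp only [map_add, hy, hz]
  | tmul y c =>
    rw [TensorProduct.map_tmul, TensorProduct.map_tmul, TensorProduct.map_tmul, P.act_refl, h1]
    generalize P.Δ g₁ ha y = y
    induction y using TensorProduct.induction_on with
    | zero => simp
    | add y z hy hz => simp only [map_add, TensorProduct.add_tmul, hy, hz]
    | tmul x y =>
      rw [TensorProduct.map_tmul, TensorProduct.lift.tmul, TensorProduct.lift.tmul,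
        LinearMap.smul_apply, LinearMap.smul_apply, LinearMap.smul_apply, LinearMap.smul_apply,
        LinearMap.compl₁₂_apply, LinearMap.compl₁₂_apply,
        P.insert_tmul g₁ _ rfl rfl (by omega), P.insert_tmul _ _ rfl rfl (by omega),
        Free.gen_act, Free.gen_act, Free.comp_act g₁ _ α β _ (g₁.map_isIso α β), Free.act_refl]
      simp only [LinearMap.id_apply]
      rw [show ∀ b : Free P.toDGCollection r (a + 2), Free.comp (g₂.map (Relabel.refl r) γ)
        (by omega : (a + 2) + (i₃ + 1) = m) b (Free.gen rfl (P.act γ c)) =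
        Free.comp g₂ (by omega) b (Free.gen rfl c) from fun b => by
          rw [← Free.act_refl b, Free.gen_act,
            Free.comp_act g₂ _ (Relabel.refl r) γ _ (g₂.map_isIso _ γ), Free.act_refl,
            Free.act_refl]]

end DGPseudoCooperad

section Summation

theorem finsum_sigma' {ι : Type u} {κ : ι → Type v} {M : Type w} [AddCommMonoid M]
    (f : (Σ i, κ i) → M) (hf : (Function.support f).Finite) :
    ∑ᶠ z, f z = ∑ᶠ i, ∑ᶠ j, f ⟨i, j⟩ := by
  classical
  have h1 : ∀ i, (Function.support fun j => f ⟨i, j⟩).Finite := fun i =>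
    hf.preimage (f := fun j => (⟨i, j⟩ : Σ i, κ i)) (fun _ _ _ _ h => by simpa using h)
  have h2 : (Function.support fun i => ∑ᶠ j, f ⟨i, j⟩) ⊆ (hf.toFinset.image Sigma.fst) := by
    intro i hi
    obtain ⟨j, hj⟩ : ∃ j, f ⟨i, j⟩ ≠ 0 := by
      by_contra! h
      exact hi (finsum_eq_zero_of_forall_eq_zero h)
    simpa using ⟨j, hj⟩
  rw [finsum_eq_sum_of_support_subset _ h2,
    finsum_eq_sum_of_support_subset f (s := (hf.toFinset.image Sigma.fst).sigma
      fun i => (h1 i).toFinset) (fun z hz => by simpa using ⟨⟨_, hz⟩, hz⟩), Finset.sum_sigma]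
  exact Finset.sum_congr rfl fun i _ => (finsum_eq_sum _ (h1 i)).symm

theorem finsum_match {A B J M : Type*} [AddCommMonoid M] (f : A → M) (g : B → M) (s : Set A)
    (t : Set B) (iA : A → J) (iB : B → J) (hA : Set.InjOn iA s) (hB : Set.InjOn iB t)
    (h1 : ∀ a ∈ s, ∃ b ∈ t, iA a = iB b) (h2 : ∀ b ∈ t, ∃ a ∈ s, iA a = iB b)
    (hv : ∀ a ∈ s, ∀ b ∈ t, iA a = iB b → f a = g b) :
    ∑ᶠ a ∈ s, f a = ∑ᶠ b ∈ t, g b := by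
  classical
  rcases isEmpty_or_nonempty B with hB' | ⟨⟨b₀⟩⟩
  · have hs : s = ∅ := Set.eq_empty_iff_forall_notMem.2 fun a ha => (hB'.false (h1 a ha).choose)
    have ht : t = ∅ := Set.eq_empty_iff_forall_notMem.2 fun b _ => hB'.false b
    simp [hs, ht]
  · have h1' : ∀ a, ∃ b, a ∈ s → b ∈ t ∧ iA a = iB b := fun a => by
      by_cases ha : a ∈ s
      · obtain ⟨b, hb, h⟩ := h1 a ha
        exact ⟨b, fun _ => ⟨hb, h⟩⟩
      · exact ⟨b₀, fun h => absurd h ha⟩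
    choose e he using h1'
    refine finsum_mem_eq_of_bijOn e ⟨fun a ha => (he a ha).1, fun a ha a' ha' h => ?_,
      fun b hb => ?_⟩ fun a ha => hv a ha _ (he a ha).1 (he a ha).2
    · exact hA ha ha' (by rw [(he a ha).2, (he a' ha').2, h])
    · obtain ⟨a, ha, h⟩ := h2 b hb
      exact ⟨a, ha, hB (he a ha).1 hb (by rw [← (he a ha).2, h])⟩

end Summation

section Cuts

variable {Ξ : Type v}

theorem exists_lowCut {t : Corolla Ξ} (T : Option (Option (Fin t.n)) → Fin 3) (h0 : T none = 0)
    (h1 : T (some none) ≠ 2) (c c' : Ξ) :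
    ∃ (K : Finset (Fin t.n)) (K' : Finset (Fin (cutLower t K c).n)),
      ∀ x, vertexOf (lowE (cutGraft (cutLower t K c) K' c') (cutGraft t K c) x) = T x := by
  classical
  let K : Finset (Fin t.n) := Finset.univ.filter fun j => T (some (some j)) = 2
  refine ⟨K, Finset.univ.filter fun w => T (some ((cutGraft t K c).e.symm (Sum.inl w))) = 1, ?_⟩
  rintro (_ | y)
  · exact h0.symm
  · change vertexOf (Sum.elim _ _ ((cutGraft t K c).e y)) = _
    rcases h : (cutGraft t K c).e y with w | w
    · have hy : (cutGraft t K c).e.symm (Sum.inl w) = y := by rw [← h, Equiv.symm_apply_apply]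
      have h2 : T (some y) ≠ 2 := by
        rcases y with _ | j
        · exact h1
        · intro hT
          have := (cutGraft_isRight t K c j).2 (by simpa [K] using hT)
          rw [h] at this
          simp at this
      have h3 := cutGraft_isRight (cutLower t K c)
        (Finset.univ.filter fun w => T (some ((cutGraft t K c).e.symm (Sum.inl w))) = 1) c' w
      rw [Finset.mem_filter, hy] at h3
      rw [Sum.elim_inl]
      generalize (cutGraft (cutLower t K c) _ c').e (some w) = v at h3 ⊢
      rcases v with v | v
      · have : T (some y) ≠ 1 := fun h => by simpa using h3.2 ⟨Finset.mem_univ _, h⟩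
        change (0 : Fin 3) = _
        generalize T (some y) = z at h2 this ⊢
        clear h3
        revert z
        decide
      · exact (h3.1 rfl).2.symm
    · rcases y with _ | j
      · rw [Graft.e_none] at h; simp at h
      · have := (cutGraft_isRight t K c j).1 (by rw [h]; rfl)
        have h2 : T (some (some j)) = 2 := by simpa [K] using this
        rw [h2]; rfl

theorem exists_uppCut {t : Corolla Ξ} (T : Option (Option (Fin t.n)) → Fin 3) (h0 : T none = 0)
    (h1 : T (some none) = 1) (c c' : Ξ) :
    ∃ (K : Finset (Fin t.n)) (K' : Finset (Fin (cutUpper t K c).n)),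
      ∀ x, vertexOf (uppE (cutGraft (cutUpper t K c) K' c') (cutGraft t K c) (swapEdges _ x)) =
        T x := by
  classical
  let K : Finset (Fin t.n) := Finset.univ.filter fun j => T (some (some j)) ≠ 0
  refine ⟨K, Finset.univ.filter fun w => ∃ j, (cutGraft t K c).e (some j) = Sum.inr w ∧
    T (some (some j)) = 2, ?_⟩
  rintro (_ | _ | j)
  · exact h0.symm
  · exact h1.symm
  · change vertexOf (Sum.map _ _ ((cutGraft t K c).e (some j))) = _
    have h2 := cutGraft_isRight t K c j
    rcases h : (cutGraft t K c).e (some j) with w | w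
    · rw [h] at h2
      have : j ∉ K := fun hj => by simpa using h2.2 hj
      have h3 : T (some (some j)) = 0 := by simpa [K] using this
      rw [h3]; rfl
    · rw [h] at h2
      have h4 : T (some (some j)) ≠ 0 := by simpa [K] using h2.1 rfl
      have h3 := cutGraft_isRight (cutUpper t K c) (Finset.univ.filter fun w =>
        ∃ j, (cutGraft t K c).e (some j) = Sum.inr w ∧ T (some (some j)) = 2) c' w
      have h5 : (∃ j, (cutGraft t K c).e (some j) = Sum.inr w ∧ T (some (some j)) = 2) ↔
          T (some (some j)) = 2 := by
        refine ⟨?_, fun h' => ⟨j, h, h'⟩⟩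
        rintro ⟨j', hj', hT⟩
        have := (cutGraft t K c).e.injective (hj'.trans h.symm)
        rw [← Option.some_injective _ this]; exact hT
      rw [Finset.mem_filter, h5] at h3
      rw [Sum.map_inr]
      generalize (cutGraft (cutUpper t K c) _ c').e (some w) = v at h3 ⊢
      rcases v with v | v
      · have : T (some (some j)) ≠ 2 := fun h => by simpa using h3.2 ⟨Finset.mem_univ _, h⟩
        change (1 : Fin 3) = _
        clear h3 h5
        generalize T (some (some j)) = z at h4 this ⊢
        revert z
        decide
      · exact (h3.1 rfl).2.symm

theorem lowCut_injective {t : Corolla Ξ} {c c' : Ξ} {K L : Finset (Fin t.n)}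
    {K' : Finset (Fin (cutLower t K c).n)} {L' : Finset (Fin (cutLower t L c).n)}
    (h : ∀ x, vertexOf (lowE (cutGraft (cutLower t K c) K' c') (cutGraft t K c) x) =
      vertexOf (lowE (cutGraft (cutLower t L c) L' c') (cutGraft t L c) x)) :
    (⟨K, K'⟩ : Σ K : Finset (Fin t.n), Finset (Fin (cutLower t K c).n)) = ⟨L, L'⟩ := by
  have key : ∀ (K : Finset (Fin t.n)) (K' : Finset (Fin (cutLower t K c).n)) (j : Fin t.n),
      j ∈ K ↔ vertexOf (lowE (cutGraft (cutLower t K c) K' c') (cutGraft t K c)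
        (some (some j))) = 2 := by
    intro K K' j
    rw [← cutGraft_isRight t K c j]
    change _ ↔ vertexOf (Sum.elim _ _ ((cutGraft t K c).e (some j))) = _
    rcases (cutGraft t K c).e (some j) with w | w
    · rw [Sum.elim_inl]
      generalize (cutGraft (cutLower t K c) _ c').e (some w) = v
      rcases v with v | v <;> simp [vertexOf]
    · simp [vertexOf]
  obtain rfl : K = L := Finset.ext fun j => by rw [key K K', key L L', h]
  have key' : ∀ (K' : Finset (Fin (cutLower t K c).n)) (w : Fin (cutLower t K c).n),
      w ∈ K' ↔ vertexOf (lowE (cutGraft (cutLower t K c) K' c') (cutGraft t K c)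
        (some ((cutGraft t K c).e.symm (Sum.inl w)))) = 1 := by
    intro K' w
    rw [← cutGraft_isRight _ K' c' w]
    change _ ↔ vertexOf (Sum.elim _ _ ((cutGraft t K c).e ((cutGraft t K c).e.symm _))) = _
    rw [Equiv.apply_symm_apply, Sum.elim_inl]
    generalize (cutGraft (cutLower t K c) _ c').e (some w) = v
    rcases v with v | v <;> simp [vertexOf]
  obtain rfl : K' = L' := Finset.ext fun j => by rw [key' K', key' L', h]
  rfl

theorem uppCut_injective {t : Corolla Ξ} {c c' : Ξ} {K L : Finset (Fin t.n)}
    {K' : Finset (Fin (cutUpper t K c).n)} {L' : Finset (Fin (cutUpper t L c).n)}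
    (h : ∀ x, vertexOf (uppE (cutGraft (cutUpper t K c) K' c') (cutGraft t K c) x) =
      vertexOf (uppE (cutGraft (cutUpper t L c) L' c') (cutGraft t L c) x)) :
    (⟨K, K'⟩ : Σ K : Finset (Fin t.n), Finset (Fin (cutUpper t K c).n)) = ⟨L, L'⟩ := by
  have key : ∀ (K : Finset (Fin t.n)) (K' : Finset (Fin (cutUpper t K c).n)) (j : Fin t.n),
      j ∈ K ↔ vertexOf (uppE (cutGraft (cutUpper t K c) K' c') (cutGraft t K c)
        (some (some j))) ≠ 0 := by
    intro K K' j
    rw [← cutGraft_isRight t K c j]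
    change _ ↔ vertexOf (Sum.map _ _ ((cutGraft t K c).e (some j))) ≠ _
    rcases (cutGraft t K c).e (some j) with w | w
    · simp [vertexOf]
    · rw [Sum.map_inr]
      generalize (cutGraft (cutUpper t K c) _ c').e (some w) = v
      rcases v with v | v <;> simp [vertexOf]
  obtain rfl : K = L := Finset.ext fun j => by rw [key K K', key L L', h]
  have key' : ∀ (K' : Finset (Fin (cutUpper t K c).n)) (w : Fin (cutUpper t K c).n),
      w ∈ K' ↔ vertexOf (uppE (cutGraft (cutUpper t K c) K' c') (cutGraft t K c)
        (some ((cutGraft t K c).e.symm (Sum.inr w)))) = 2 := by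
    intro K' w
    rw [← cutGraft_isRight _ K' c' w]
    change _ ↔ vertexOf (Sum.map _ _ ((cutGraft t K c).e ((cutGraft t K c).e.symm _))) = _
    rw [Equiv.apply_symm_apply, Sum.map_inr]
    generalize (cutGraft (cutUpper t K c) _ c').e (some w) = v
    rcases v with v | v <;> simp [vertexOf]
  obtain rfl : K' = L' := Finset.ext fun j => by rw [key' K', key' L', h]
  rfl

end Cuts

namespace DGPseudoCooperad

variable {k : Type u} [Field k] {Ξ : Type v} (P : DGPseudoCooperad.{u, v, w} k Ξ)

theorem lowV_eq_uppV {p q s p' q' s' r t u : Corolla Ξ} {i₁ i₂ i₃ a j₁ j₂ j₃ b n m : ℤ}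
    (g₁ : Graft p q r) (g₂ : Graft r s t) (h₁ : Graft q' s' u) (h₂ : Graft p' u t)
    (ha : i₁ + i₂ = a) (hn : a + i₃ = n) (hb : j₂ + j₃ = b) (hn' : j₁ + b = n) (hm : n + 3 = m)
    (hq : q'.out = q.out) (hs : s'.out = s.out)
    (hv : ∀ x, vertexOf (uppE h₁ h₂ (swapEdges _ x)) = vertexOf (lowE g₁ g₂ x))
    (e₁ : i₁ = j₁) (e₂ : i₂ = j₂) (x : P.X t n) :
    P.lowV g₁ g₂ ha hn hm x = P.uppV h₁ h₂ hb hn' hm x := by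
  subst e₁ e₂
  obtain rfl : i₃ = j₃ := by omega
  obtain ⟨α, β, γ, H⟩ := exists_seqTree g₁ g₂ h₁ h₂ hq hs hv
  rw [← P.lowV_map g₁ g₂ α β γ, P.lowV_seq _ _ h₁ h₂ H]

theorem lowV_eq_neg {p q s p' q' s' r t u : Corolla Ξ} {i₁ i₂ i₃ a j₁ j₂ j₃ b n m : ℤ}
    (g₁ : Graft p q r) (g₂ : Graft r s t) (h₁ : Graft p' s' u) (h₂ : Graft u q' t)
    (ha : i₁ + i₂ = a) (hn : a + i₃ = n) (hb : j₁ + j₃ = b) (hn' : b + j₂ = n) (hm : n + 3 = m)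
    (hq : q'.out = q.out) (hs : s'.out = s.out)
    (hv : ∀ x, vertexOf (Sum.map id Sum.swap (lowE h₁ h₂ (swapEdges _ x))) =
      vertexOf (lowE g₁ g₂ x))
    (e₁ : i₁ = j₁) (e₂ : i₂ = j₂) (x : P.X t n) :
    P.lowV g₁ g₂ ha hn hm x = -P.lowV h₁ h₂ hb hn' hm x := by
  subst e₁ e₂
  obtain rfl : i₃ = j₃ := by omega
  obtain ⟨α, β, γ, H⟩ := exists_parTree g₁ g₂ h₁ h₂ hq hs hv
  rw [← P.lowV_map g₁ g₂ α β γ, P.lowV_par _ _ h₁ h₂ H]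

/-- The isomorphism classes of trees with two vertices over the lower vertex of such a tree. -/
abbrev LowIdx (t : Corolla Ξ) : Type v :=
  Σ y : (Finset (Fin t.n) × Ξ) × ℤ, (Finset (Fin (cutLower t y.1.1 y.1.2).n) × Ξ) × ℤ

/-- The isomorphism classes of trees with two vertices over the upper vertex of such a tree. -/
abbrev UppIdx (t : Corolla Ξ) : Type v :=
  Σ y : (Finset (Fin t.n) × Ξ) × ℤ, (Finset (Fin (cutUpper t y.1.1 y.1.2).n) × Ξ) × ℤ

/-- The term for an element of `LowIdx`. -/
def lowTerm {t : Corolla Ξ} {n m : ℤ} (hm : n + 3 = m) (x : P.X t n) (z : LowIdx t) :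
    Free P.toDGCollection t m :=
  P.lowV (cutGraft (cutLower t z.1.1.1 z.1.1.2) z.2.1.1 z.2.1.2) (cutGraft t z.1.1.1 z.1.1.2)
    (add_sub_cancel z.2.2 z.1.2) (add_sub_cancel z.1.2 n) hm x

/-- The term for an element of `UppIdx`. -/
def uppTerm {t : Corolla Ξ} {n m : ℤ} (hm : n + 3 = m) (x : P.X t n) (z : UppIdx t) :
    Free P.toDGCollection t m :=
  P.uppV (cutGraft (cutUpper t z.1.1.1 z.1.1.2) z.2.1.1 z.2.1.2) (cutGraft t z.1.1.1 z.1.1.2)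
    (add_sub_cancel z.2.2 (n - z.1.2)) (add_sub_cancel z.1.2 n) hm x

/-- The tree, the colors of the internal edges and the degrees. -/
def lowInv {t : Corolla Ξ} (z : LowIdx t) :
    (Option (Option (Fin t.n)) → Fin 3) × (Ξ × Ξ) × (ℤ × ℤ) :=
  (fun x => vertexOf (lowE (cutGraft (cutLower t z.1.1.1 z.1.1.2) z.2.1.1 z.2.1.2)
    (cutGraft t z.1.1.1 z.1.1.2) x), (z.2.1.2, z.1.1.2), (z.2.2, z.1.2 - z.2.2))

/-- The tree, the colors of the internal edges and the degrees. -/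
def uppInv {t : Corolla Ξ} (z : UppIdx t) :
    (Option (Option (Fin t.n)) → Fin 3) × (Ξ × Ξ) × (ℤ × ℤ) :=
  (fun x => vertexOf (uppE (cutGraft (cutUpper t z.1.1.1 z.1.1.2) z.2.1.1 z.2.1.2)
    (cutGraft t z.1.1.1 z.1.1.2) (swapEdges _ x)), (z.1.1.2, z.2.1.2), (z.1.2, z.2.2))

theorem lowInv_injective {t : Corolla Ξ} : Function.Injective (lowInv (t := t)) := by
  rintro ⟨⟨⟨K, c⟩, a⟩, ⟨K', c'⟩, i⟩ ⟨⟨⟨L, d⟩, b⟩, ⟨L', d'⟩, j⟩ h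
  simp only [lowInv, Prod.mk.injEq] at h
  obtain ⟨hT, ⟨hc', hc⟩, hi, ha⟩ := h
  subst hc hc' hi
  obtain rfl : a = b := by omega
  cases lowCut_injective (congrFun hT)
  rfl

theorem uppInv_injective {t : Corolla Ξ} : Function.Injective (uppInv (t := t)) := by
  rintro ⟨⟨⟨K, c⟩, a⟩, ⟨K', c'⟩, i⟩ ⟨⟨⟨L, d⟩, b⟩, ⟨L', d'⟩, j⟩ h
  simp only [uppInv, Prod.mk.injEq] at h
  obtain ⟨hT, ⟨hc', hc⟩, hi, ha⟩ := h
  subst hc hc' hi ha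
  cases uppCut_injective (fun x => by
    simpa using congrFun hT ((swapEdges _).symm x))
  rfl

theorem exists_lowInv {t : Corolla Ξ} (T : Option (Option (Fin t.n)) → Fin 3) (h0 : T none = 0)
    (h1 : T (some none) ≠ 2) (c c' : Ξ) (i j : ℤ) :
    ∃ z : LowIdx t, lowInv z = (T, (c', c), (i, j)) := by
  obtain ⟨K, K', h⟩ := exists_lowCut T h0 h1 c c'
  refine ⟨⟨((K, c), i + j), ((K', c'), i)⟩, ?_⟩
  refine Prod.ext (funext h) (Prod.ext rfl (Prod.ext rfl ?_))
  change i + j - i = j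
  omega

theorem exists_uppInv {t : Corolla Ξ} (T : Option (Option (Fin t.n)) → Fin 3) (h0 : T none = 0)
    (h1 : T (some none) = 1) (c c' : Ξ) (i j : ℤ) :
    ∃ z : UppIdx t, uppInv z = (T, (c, c'), (i, j)) := by
  obtain ⟨K, K', h⟩ := exists_uppCut T h0 h1 c c'
  exact ⟨⟨((K, c), i), ((K', c'), j)⟩, Prod.ext (funext h) rfl⟩

theorem lowInv_none {t : Corolla Ξ} (z : LowIdx t) : (lowInv z).1 none = 0 := rfl

theorem lowInv_some_none {t : Corolla Ξ} (z : LowIdx t) : (lowInv z).1 (some none) ≠ 2 := by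
  change vertexOf (Sum.map id Sum.inl ((cutGraft (cutLower t _ _) z.2.1.1 z.2.1.2).e
    (some (cutGraft t z.1.1.1 z.1.1.2).edge))) ≠ 2
  generalize (cutGraft (cutLower t _ _) z.2.1.1 z.2.1.2).e _ = v
  rcases v with v | v <;> simp [vertexOf]

theorem uppInv_none {t : Corolla Ξ} (z : UppIdx t) : (uppInv z).1 none = 0 := rfl

theorem uppInv_some_none {t : Corolla Ξ} (z : UppIdx t) : (uppInv z).1 (some none) = 1 := rfl

/-- Exchange of the two upper vertices. -/
def swapVertex : Fin 3 → Fin 3 := ![0, 2, 1]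

theorem vertexOf_swap {A B C : Type} (x : A ⊕ (B ⊕ C)) :
    vertexOf (Sum.map id Sum.swap x) = swapVertex (vertexOf x) := by
  rcases x with x | x | x <;> rfl

/-- The terms of the two double sums that belong to trees with three vertices, one above the
other, agree. -/
theorem sum_seq {t : Corolla Ξ} {n m : ℤ} (hm : n + 3 = m) (x : P.X t n) :
    ∑ᶠ z ∈ {z : LowIdx t | (lowInv z).1 (some none) = 1}, P.lowTerm hm x z =
      ∑ᶠ z, P.uppTerm hm x z := by
  rw [← finsum_mem_univ (P.uppTerm hm x)]
  refine finsum_match _ _ _ _ lowInv uppInv lowInv_injective.injOn uppInv_injective.injOn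
    (fun z hz => ?_) (fun z _ => ?_) fun z _ z' _ h => ?_
  · obtain ⟨z', h⟩ := exists_uppInv (lowInv z).1 (lowInv_none z) hz (lowInv z).2.1.1
      (lowInv z).2.1.2 (lowInv z).2.2.1 (lowInv z).2.2.2
    exact ⟨z', trivial, h.symm⟩
  · obtain ⟨z', h⟩ := exists_lowInv (uppInv z).1 (uppInv_none z)
      (by rw [uppInv_some_none]; decide) (uppInv z).2.1.2
      (uppInv z).2.1.1 (uppInv z).2.2.1 (uppInv z).2.2.2
    refine ⟨z', ?_, h⟩
    change (lowInv z').1 _ = 1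
    rw [h, uppInv_some_none]
  · simp only [lowInv, uppInv, Prod.mk.injEq] at h
    obtain ⟨hT, ⟨hc', hc⟩, hi, ha⟩ := h
    rw [lowTerm, uppTerm]
    refine P.lowV_eq_uppV _ _ _ _ _ _ _ _ hm ?_ ?_ (fun x => (congrFun hT x).symm) hi ha x
    · exact hc'.symm
    · exact hc.symm

/-- The terms for the other trees with three vertices cancel each other. -/
theorem sum_par [CharZero k] {t : Corolla Ξ} {n m : ℤ} (hm : n + 3 = m) (x : P.X t n) :
    ∑ᶠ z ∈ {z : LowIdx t | (lowInv z).1 (some none) = 0}, P.lowTerm hm x z = 0 := by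
  have h : ∑ᶠ z ∈ {z : LowIdx t | (lowInv z).1 (some none) = 0}, P.lowTerm hm x z =
      ∑ᶠ z ∈ {z : LowIdx t | (lowInv z).1 (some none) = 0}, -P.lowTerm hm x z := by
    refine finsum_match _ _ _ _ lowInv (fun z : LowIdx t =>
      (((fun y => swapVertex ((lowInv z).1 (swapEdges _ y)), ((lowInv z).2.1.2, (lowInv z).2.1.1),
        ((lowInv z).2.2.1, n - (lowInv z).2.2.1 - (lowInv z).2.2.2)) :
        (Option (Option (Fin t.n)) → Fin 3) × (Ξ × Ξ) × (ℤ × ℤ)))) lowInv_injective.injOn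
      (fun z _ z' _ h => ?_) (fun z hz => ?_) (fun z hz => ?_) fun z _ z' _ h => ?_
    · have hs : Function.Injective swapVertex := by decide
      simp only [Prod.mk.injEq] at h
      obtain ⟨hT, ⟨hc', hc⟩, hi, ha⟩ := h
      refine lowInv_injective (Prod.ext (funext fun y => ?_) (Prod.ext (Prod.ext hc hc')
        (Prod.ext hi ?_)))
      · have := hs (congrFun hT ((swapEdges _).symm y))
        simpa using this
      · omega
    · obtain ⟨z', h⟩ := exists_lowInv (fun y => swapVertex ((lowInv z).1 (swapEdges _ y)))
        (by change swapVertex ((lowInv z).1 (some none)) = 0; rw [hz]; rfl)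
        (by change swapVertex 0 ≠ 2; decide) (lowInv z).2.1.1 (lowInv z).2.1.2 (lowInv z).2.2.1
        (n - (lowInv z).2.2.1 - (lowInv z).2.2.2)
      have hs : ∀ v, swapVertex (swapVertex v) = v := by decide
      refine ⟨z', ?_, ?_⟩
      · change (lowInv z').1 _ = 0
        rw [h]
        rfl
      · rw [h]
        refine Prod.ext (funext fun y => ?_) (Prod.ext rfl (Prod.ext rfl ?_))
        · change _ = swapVertex (swapVertex _)
          rw [hs]
          rcases y with _ | _ | y <;> rfl
        · change (lowInv z).2.2.2 =
            n - (lowInv z).2.2.1 - (n - (lowInv z).2.2.1 - (lowInv z).2.2.2)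
          omega
    · obtain ⟨z', h⟩ := exists_lowInv (fun y => swapVertex ((lowInv z).1 (swapEdges _ y)))
        (by change swapVertex ((lowInv z).1 (some none)) = 0; rw [hz]; rfl)
        (by change swapVertex 0 ≠ 2; decide) (lowInv z).2.1.1 (lowInv z).2.1.2 (lowInv z).2.2.1
        (n - (lowInv z).2.2.1 - (lowInv z).2.2.2)
      refine ⟨z', ?_, h⟩
      change (lowInv z').1 _ = 0
      rw [h]
      rfl
    · simp only [lowInv, Prod.mk.injEq] at h
      obtain ⟨hT, ⟨hc', hc⟩, hi, ha⟩ := h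
      rw [lowTerm, lowTerm]
      refine P.lowV_eq_neg _ _ _ _ _ _ _ _ hm ?_ ?_ (fun y => ?_) hi ?_ x
      · exact hc'.symm
      · exact hc.symm
      · rw [vertexOf_swap]
        exact (congrFun hT y).symm
      · omega
  have hneg : ∑ᶠ z ∈ {z : LowIdx t | (lowInv z).1 (some none) = 0}, -P.lowTerm hm x z =
      -∑ᶠ z ∈ {z : LowIdx t | (lowInv z).1 (some none) = 0}, P.lowTerm hm x z := by
    simp only [finsum_mem_def, Set.indicator_neg]
    rw [← finsum_neg_distrib]
  rw [hneg] at h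
  have h2 : (2 : k) • ∑ᶠ z ∈ {z : LowIdx t | (lowInv z).1 (some none) = 0},
      P.lowTerm hm x z = 0 := by
    rw [two_smul, add_eq_zero_iff_eq_neg]
    exact h
  exact (smul_eq_zero.1 h2).resolve_left two_ne_zero

theorem finite_map_left {p : Corolla Ξ} {i : ℤ} {V : Type w₁} [AddCommGroup V] [Module k V]
    (y : P.X p i ⊗[k] V) :
    {t : (Finset (Fin p.n) × Ξ) × ℤ | TensorProduct.map
      (P.Δ (cutGraft p t.1.1 t.1.2) (add_sub_cancel t.2 i)) (LinearMap.id (M := V)) y ≠ 0}.Finite := by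
  induction y using TensorProduct.induction_on with
  | zero => simp
  | tmul a b =>
    refine (P.finite_cut a).subset fun t ht h0 => ht ?_
    rw [TensorProduct.map_tmul, h0, TensorProduct.zero_tmul]
  | add a b ha hb =>
    refine (ha.union hb).subset fun t ht => ?_
    by_contra! h
    simp only [Set.mem_union, Set.mem_ofPred_eq, not_or, not_not] at h
    exact ht (by rw [map_add, h.1, h.2, add_zero])

theorem finite_map_right {p : Corolla Ξ} {i : ℤ} {V : Type w₁} [AddCommGroup V] [Module k V]
    (y : V ⊗[k] P.X p i) :
    {t : (Finset (Fin p.n) × Ξ) × ℤ | TensorProduct.map (LinearMap.id (M := V))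
      (P.Δ (cutGraft p t.1.1 t.1.2) (add_sub_cancel t.2 i)) y ≠ 0}.Finite := by
  induction y using TensorProduct.induction_on with
  | zero => simp
  | tmul a b =>
    refine (P.finite_cut b).subset fun t ht h0 => ht ?_
    rw [TensorProduct.map_tmul, h0, TensorProduct.tmul_zero]
  | add a b ha hb =>
    refine (ha.union hb).subset fun t ht => ?_
    by_contra! h
    simp only [Set.mem_union, Set.mem_ofPred_eq, not_or, not_not] at h
    exact ht (by rw [map_add, h.1, h.2, add_zero])

theorem lowTerm_eq_zero {t : Corolla Ξ} {n m : ℤ} (hm : n + 3 = m) (x : P.X t n) (z : LowIdx t)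
    (h : P.Δ (cutGraft t z.1.1.1 z.1.1.2) (add_sub_cancel z.1.2 n) x = 0) :
    P.lowTerm hm x z = 0 := by
  rw [lowTerm, lowV, LinearMap.comp_apply, LinearMap.comp_apply, h, map_zero, map_zero]

theorem uppTerm_eq_zero {t : Corolla Ξ} {n m : ℤ} (hm : n + 3 = m) (x : P.X t n) (z : UppIdx t)
    (h : P.Δ (cutGraft t z.1.1.1 z.1.1.2) (add_sub_cancel z.1.2 n) x = 0) :
    P.uppTerm hm x z = 0 := by
  rw [uppTerm, uppV, LinearMap.comp_apply, LinearMap.comp_apply, h, map_zero, map_zero]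

theorem finite_lowTerm {t : Corolla Ξ} {n m : ℤ} (hm : n + 3 = m) (x : P.X t n) :
    (Function.support (P.lowTerm hm x)).Finite := by
  refine ((P.finite_cut x).biUnion fun y _ => (P.finite_map_left
    (P.Δ (cutGraft t y.1.1 y.1.2) (add_sub_cancel y.2 n) x)).image
      fun z => (⟨y, z⟩ : LowIdx t)).subset fun z hz => ?_
  simp only [Set.mem_iUnion]
  refine ⟨z.1, fun h => hz ?_, z.2, fun h => hz ?_, rfl⟩
  · exact P.lowTerm_eq_zero hm x z h
  · rw [lowTerm, lowV, LinearMap.comp_apply, LinearMap.comp_apply, h, map_zero]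

theorem finite_uppTerm {t : Corolla Ξ} {n m : ℤ} (hm : n + 3 = m) (x : P.X t n) :
    (Function.support (P.uppTerm hm x)).Finite := by
  refine ((P.finite_cut x).biUnion fun y _ => (P.finite_map_right
    (P.Δ (cutGraft t y.1.1 y.1.2) (add_sub_cancel y.2 n) x)).image
      fun z => (⟨y, z⟩ : UppIdx t)).subset fun z hz => ?_
  simp only [Set.mem_iUnion]
  refine ⟨z.1, fun h => hz ?_, z.2, fun h => hz ?_, rfl⟩
  · exact P.uppTerm_eq_zero hm x z h
  · rw [uppTerm, uppV, LinearMap.comp_apply, LinearMap.comp_apply, h, map_zero]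

/-- The two double sums agree. -/
theorem sum_low_eq_sum_upp [CharZero k] {t : Corolla Ξ} {n m : ℤ} (hm : n + 3 = m)
    (x : P.X t n) : ∑ᶠ z, P.lowTerm hm x z = ∑ᶠ z, P.uppTerm hm x z := by
  rw [← P.sum_seq hm x, ← finsum_mem_univ (P.lowTerm hm x),
    show (Set.univ : Set (LowIdx t)) = {z | (lowInv z).1 (some none) = 1} ∪
      {z | (lowInv z).1 (some none) = 0} from (Set.eq_univ_of_forall fun z => by
        have := lowInv_some_none z
        simp only [Set.mem_union, Set.mem_ofPred_eq]
        generalize (lowInv z).1 (some none) = v at *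
        revert v
        decide).symm,
    finsum_mem_union', P.sum_par hm x, add_zero]
  · exact Set.disjoint_left.2 fun z (h : _ = _) (h' : _ = _) => by rw [h] at h'; simp at h'
  · exact (P.finite_lowTerm hm x).subset Set.inter_subset_right
  · exact (P.finite_lowTerm hm x).subset Set.inter_subset_right

/-- The quadratic part of the cobar differential at the lower vertex of `g`. -/
noncomputable def lowQuad {p q r : Corolla Ξ} {i j m : ℤ} (g : Graft p q r) (h : i + j + 3 = m) :
    P.X p i ⊗[k] P.X q j →ₗ[k] Free P.toDGCollection r m :=
  TensorProduct.lift (i.negOnePow •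
    (Free.comp g (by omega : (i + 2) + (j + 1) = m)).compl₁₂ (P.cobarQuad rfl) (Free.gen rfl))

/-- The quadratic part of the cobar differential at the upper vertex of `g`. -/
noncomputable def uppQuad {p q r : Corolla Ξ} {i j m : ℤ} (g : Graft p q r) (h : i + j + 3 = m) :
    P.X p i ⊗[k] P.X q j →ₗ[k] Free P.toDGCollection r m :=
  TensorProduct.lift
    ((Free.comp g (by omega : (i + 1) + (j + 2) = m)).compl₁₂ (Free.gen rfl) (P.cobarQuad rfl))

theorem cobarD_insert {p q r : Corolla Ξ} {i j m m' : ℤ} (g : Graft p q r) (h : i + j + 2 = m)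
    (h' : m + 1 = m') (y : P.X p i ⊗[k] P.X q j) :
    P.cobarD h' (P.insert g h y) =
      P.insert g (by omega : i + 1 + j + 2 = m')
        (TensorProduct.map (P.d rfl) LinearMap.id y) +
      i.negOnePow • P.insert g (by omega : i + (j + 1) + 2 = m')
        (TensorProduct.map LinearMap.id (P.d rfl) y) -
      P.lowQuad g (by omega) y + P.uppQuad g (by omega) y := by
  induction y using TensorProduct.induction_on with
  | zero => simp
  | add y z hy hz => simp only [map_add, hy, hz, smul_add]; abel
  | tmul x y =>
    rw [TensorProduct.map_tmul, TensorProduct.map_tmul,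
      P.insert_tmul g _ rfl rfl (by omega),
      P.insert_tmul g _ (by omega : i + 1 + 1 = i + 2) rfl (by omega),
      P.insert_tmul g _ rfl (by omega : j + 1 + 1 = j + 2) (by omega), lowQuad, uppQuad, TensorProduct.lift.tmul,
      TensorProduct.lift.tmul, LinearMap.smul_apply, LinearMap.smul_apply,
      LinearMap.compl₁₂_apply, LinearMap.compl₁₂_apply, Units.smul_def i.negOnePow, map_zsmul,
      ← Units.smul_def i.negOnePow,
      P.cobarD_comp g _ (by omega : i + 1 + 1 = i + 2) (by omega : j + 1 + 1 = j + 2) h'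
        (by omega) (by omega), cobarD_gen, cobarD_gen, cobarGen,
      cobarGen]
    simp only [LinearMap.sub_apply, LinearMap.neg_apply, LinearMap.comp_apply, map_sub, map_neg,
      LinearMap.id_apply, Int.negOnePow_succ, smul_add, smul_sub, smul_neg, Units.neg_smul,
      smul_smul, ← Int.negOnePow_add, Int.negOnePow_even _ (Even.add_self i), one_smul]
    abel

theorem lowQuad_eq {p q r : Corolla Ξ} {i j n m : ℤ} (g : Graft p q r) (hn : i + j = n)
    (hm : n + 3 = m) (x : P.X r n) :
    P.lowQuad g (by omega) (P.Δ g hn x) = ∑ᶠ z : (Finset (Fin p.n) × Ξ) × ℤ,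
      P.lowV (cutGraft p z.1.1 z.1.2) g (add_sub_cancel z.2 i) hn hm x := by
  simp only [lowV, LinearMap.comp_apply]
  generalize P.Δ g hn x = y
  induction y using TensorProduct.induction_on with
  | zero => simp
  | add y z hy hz =>
    simp only [map_add]
    rw [finsum_add_distrib, hy, hz]
    · exact (P.finite_map_left y).subset fun t ht h0 => ht (by
        dsimp only
        rw [h0, map_zero])
    · exact (P.finite_map_left z).subset fun t ht h0 => ht (by
        dsimp only
        rw [h0, map_zero])
  | tmul a b =>
    simp only [TensorProduct.map_tmul, TensorProduct.lift.tmul, lowQuad, LinearMap.smul_apply,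
      LinearMap.compl₁₂_apply, LinearMap.id_apply]
    have hf := P.finite_cobarTerm (rfl : i + 2 = i + 2) a
    rw [show P.cobarQuad rfl a = ∑ᶠ t : (Finset (Fin p.n) × Ξ) × ℤ,
      P.cobarTerm (cutGraft p t.1.1 t.1.2) t.2 rfl a from rfl]
    exact map_finsum (i.negOnePow • (Free.comp g (by omega : (i + 2) + (j + 1) = m)).flip
      (Free.gen rfl b)) hf

theorem uppQuad_eq {p q r : Corolla Ξ} {i j n m : ℤ} (g : Graft p q r) (hn : i + j = n)
    (hm : n + 3 = m) (x : P.X r n) :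
    P.uppQuad g (by omega) (P.Δ g hn x) = ∑ᶠ z : (Finset (Fin q.n) × Ξ) × ℤ,
      P.uppV (cutGraft q z.1.1 z.1.2) g (add_sub_cancel z.2 j) hn hm x := by
  simp only [uppV, LinearMap.comp_apply]
  generalize P.Δ g hn x = y
  induction y using TensorProduct.induction_on with
  | zero => simp
  | add y z hy hz =>
    simp only [map_add]
    rw [finsum_add_distrib, hy, hz]
    · exact (P.finite_map_right y).subset fun t ht h0 => ht (by
        dsimp only
        rw [h0, map_zero])
    · exact (P.finite_map_right z).subset fun t ht h0 => ht (by
        dsimp only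
        rw [h0, map_zero])
  | tmul a b =>
    simp only [TensorProduct.map_tmul, TensorProduct.lift.tmul, uppQuad,
      LinearMap.compl₁₂_apply, LinearMap.id_apply]
    have hf := P.finite_cobarTerm (rfl : j + 2 = j + 2) b
    rw [show P.cobarQuad rfl b = ∑ᶠ t : (Finset (Fin q.n) × Ξ) × ℤ,
      P.cobarTerm (cutGraft q t.1.1 t.1.2) t.2 rfl b from rfl]
    exact map_finsum (Free.comp g (by omega : (i + 1) + (j + 2) = m) (Free.gen rfl a)) hf

/-- The quadratic part of the cobar differential of a differential. -/
theorem cobarQuad_d {r : Corolla Ξ} {n n' m : ℤ} (hn : n + 1 = n') (hm : n' + 2 = m)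
    (x : P.X r n) : P.cobarQuad hm (P.d hn x) =
      (∑ᶠ t : (Finset (Fin r.n) × Ξ) × ℤ, P.insert (cutGraft r t.1.1 t.1.2) (by omega)
        (TensorProduct.map (P.d (rfl : t.2 + 1 = t.2 + 1)) LinearMap.id
          (P.Δ (cutGraft r t.1.1 t.1.2) (add_sub_cancel t.2 n) x))) +
      ∑ᶠ t : (Finset (Fin r.n) × Ξ) × ℤ, t.2.negOnePow • P.insert (cutGraft r t.1.1 t.1.2)
        (by omega) (TensorProduct.map LinearMap.id (P.d (rfl : n - t.2 + 1 = n - t.2 + 1))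
          (P.Δ (cutGraft r t.1.1 t.1.2) (add_sub_cancel t.2 n) x)) := by
  subst hn hm
  have key₁ : ∀ {p q : Corolla Ξ} (g : Graft p q r) {i j i' : ℤ} (a : ℤ) (h : i + j = n)
      (hi : i + 1 = i') (e : i' + j + 2 = n + 1 + 2) (_ : i = a),
      P.insert g e (TensorProduct.map (P.d hi) LinearMap.id (P.Δ g h x)) =
      P.insert g (by omega) (TensorProduct.map (P.d (rfl : a + 1 = a + 1)) LinearMap.id
        (P.Δ g (add_sub_cancel a n) x)) := by
    rintro p q g i j i' a h hi e rfl
    obtain rfl : j = n - i := by omega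
    subst hi
    rfl
  have key₂ : ∀ {p q : Corolla Ξ} (g : Graft p q r) {i j j' : ℤ} (h : i + j = n)
      (hj : j + 1 = j') (e : i + j' + 2 = n + 1 + 2),
      P.insert g e (TensorProduct.map LinearMap.id (P.d hj) (P.Δ g h x)) =
      P.insert g (by omega) (TensorProduct.map LinearMap.id
        (P.d (rfl : n - i + 1 = n - i + 1)) (P.Δ g (add_sub_cancel i n) x)) := by
    rintro p q g i j j' h hj e
    obtain rfl : j = n - i := by omega
    subst hj
    rfl
  let s : (Finset (Fin r.n) × Ξ) × ℤ ≃ (Finset (Fin r.n) × Ξ) × ℤ :=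
    Equiv.prodCongr (Equiv.refl _) (Equiv.subRight 1)
  have h : ∀ t : (Finset (Fin r.n) × Ξ) × ℤ, P.cobarTerm (cutGraft r t.1.1 t.1.2) t.2
      (rfl : n + 1 + 2 = n + 1 + 2) (P.d rfl x) =
      P.insert (cutGraft r (s t).1.1 (s t).1.2) (by omega)
        (TensorProduct.map (P.d (rfl : (s t).2 + 1 = (s t).2 + 1)) LinearMap.id
          (P.Δ (cutGraft r (s t).1.1 (s t).1.2) (add_sub_cancel (s t).2 n) x)) +
      t.2.negOnePow • P.insert (cutGraft r t.1.1 t.1.2)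
        (by omega) (TensorProduct.map LinearMap.id (P.d (rfl : n - t.2 + 1 = n - t.2 + 1))
          (P.Δ (cutGraft r t.1.1 t.1.2) (add_sub_cancel t.2 n) x)) := by
    intro t
    rw [cobarTerm, LinearMap.comp_apply, P.Δ_d _ (sub_add_cancel t.2 1)
      (by omega : n - t.2 + 1 = n + 1 - t.2) rfl _ (by omega) (by omega), map_add,
      Units.smul_def, map_zsmul, ← Units.smul_def, key₂, key₁ _ (t.2 - 1) _ _ _ rfl]
    rfl
  rw [← finsum_comp_equiv s, ← finsum_add_distrib]
  · exact finsum_congr h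
  · refine ((P.finite_cut x).preimage s.injective.injOn).subset fun t ht h0 => ht ?_
    dsimp only
    rw [h0, map_zero, map_zero]
  · refine (P.finite_cut x).subset fun t ht h0 => ht ?_
    dsimp only
    rw [h0, map_zero, map_zero, smul_zero]

theorem cobarD_cobarGen [CharZero k] {r : Corolla Ξ} {n m m' : ℤ} (h : n + 2 = m)
    (h' : m + 1 = m') (x : P.X r n) : P.cobarD h' (P.cobarGen h x) = 0 := by
  have e : P.cobarD h' (P.cobarQuad h x) = P.cobarQuad (by omega) (P.d (rfl : n + 1 = n + 1) x) -
      (∑ᶠ z, P.lowTerm (by omega : n + 3 = m') x z) +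
      ∑ᶠ z, P.uppTerm (by omega : n + 3 = m') x z := by
    rw [show P.cobarQuad h x = ∑ᶠ t : (Finset (Fin r.n) × Ξ) × ℤ,
      P.cobarTerm (cutGraft r t.1.1 t.1.2) t.2 h x from rfl,
      map_finsum _ (P.finite_cobarTerm h x), cobarQuad_d, finsum_sigma' _ (P.finite_lowTerm _ x),
      finsum_sigma' _ (P.finite_uppTerm _ x), ← finsum_add_distrib, ← finsum_sub_distrib,
      ← finsum_add_distrib]
    · refine finsum_congr fun t => ?_
      rw [cobarTerm, LinearMap.comp_apply, cobarD_insert, P.lowQuad_eq _ _ (by omega),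
        P.uppQuad_eq _ _ (by omega)]
      rfl
    all_goals
      refine (P.finite_cut x).subset fun t ht h0 => ht ?_
      have hl : ∀ z, P.lowTerm (by omega : n + 3 = m') x ⟨t, z⟩ = 0 := fun z =>
        P.lowTerm_eq_zero _ x ⟨t, z⟩ h0
      have hu : ∀ z, P.uppTerm (by omega : n + 3 = m') x ⟨t, z⟩ = 0 := fun z =>
        P.uppTerm_eq_zero _ x ⟨t, z⟩ h0
      simp only [h0, hl, hu, map_zero, smul_zero, finsum_zero, add_zero, sub_zero]
  rw [cobarGen, LinearMap.sub_apply, LinearMap.neg_apply, LinearMap.comp_apply, map_sub, map_neg,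
    e, P.sum_low_eq_sum_upp, sub_add_cancel, cobarD_gen, cobarGen, LinearMap.sub_apply,
    LinearMap.neg_apply, LinearMap.comp_apply, P.d_d, map_zero]
  simp

theorem cobarD_cobarD [CharZero k] {r : Corolla Ξ} {n m l : ℤ} (h : n + 1 = m) (h' : m + 1 = l)
    (a : Free P.toDGCollection r n) : P.cobarD h' (P.cobarD h a) = 0 := by
  revert m l
  refine Free.induct (C := fun {r n} a => ∀ {m l : ℤ} (h : n + 1 = m) (h' : m + 1 = l),
    P.cobarD h' (P.cobarD h a) = 0) ?_ ?_ ?_ ?_ ?_ ?_ ?_ a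
  · intro r n m e x m' l h h'
    rw [cobarD_gen, cobarD_cobarGen]
  · intro c m l h h'
    rw [cobarD_one, map_zero]
  · intro p q n σ a ih m l h h'
    rw [← cobarD_act, ← cobarD_act, ih, map_zero]
  · intro p q r m n d g e a b iha ihb m' l h h'
    rw [P.cobarD_comp g e rfl rfl h (by omega) (by omega), map_add, Units.smul_def, map_zsmul,
      P.cobarD_comp g _ rfl rfl h' (by omega) (by omega),
      P.cobarD_comp g _ rfl rfl h' (by omega) (by omega), iha, ihb]
    simp [← Units.smul_def, Int.negOnePow_succ]
  · intros
    simp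
  · intro r n a b ha hb m l h h'
    rw [map_add, map_add, ha, hb, add_zero]
  · intro r n c a ha m l h h'
    rw [map_smul, map_smul, ha, smul_zero]

/-- The cobar construction: the free operad generated by the suspension of `P`, with the
differential that is determined by `P`. -/
noncomputable def cobar [CharZero k] : DGOperad.{u, v, max u v w} k Ξ where
  X := Free P.toDGCollection
  d := P.cobarD
  d_d := P.cobarD_cobarD
  act := Free.act
  act_refl := Free.act_refl
  act_trans := Free.act_trans
  act_d := P.cobarD_act
  one := Free.one
  comp := Free.comp
  d_comp := P.cobarD_comp
  comp_act := Free.comp_act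
  one_comp := Free.one_comp
  comp_one := Free.comp_one
  comp_seq := Free.comp_seq
  comp_par := Free.comp_par

end DGPseudoCooperad

/-! ### The additional grading of the pseudo-cooperad -/

/-- A grading `P = ⨁ G j` (with `j ≥ 1`) of a dg pseudo-cooperad by subcollections of graded vector
spaces, which is lowered by one by the differential and is preserved by the comultiplications. -/
structure DGPseudoCooperad.Grading {k : Type u} [Field k] {Ξ : Type v}
    (P : DGPseudoCooperad.{u, v, w} k Ξ) where
  G : ℕ → ∀ (r : Corolla Ξ) (n : ℤ), Submodule k (P.X r n)
  G_zero : ∀ r n, G 0 r n = ⊥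
  isInternal : ∀ r n, DirectSum.IsInternal fun j => G j r n
  act_mem : ∀ {j : ℕ} {p q : Corolla Ξ} {n : ℤ} (σ : Relabel p q) {x : P.X p n},
    x ∈ G j p n → P.act σ x ∈ G j q n
  d_mem : ∀ {j : ℕ} {r : Corolla Ξ} {m n : ℤ} (h : m + 1 = n) {x : P.X r m},
    x ∈ G (j + 1) r m → P.d h x ∈ G j r n
  Δ_mem : ∀ {j : ℕ} {p q r : Corolla Ξ} {m l n : ℤ} (g : Graft p q r) (h : m + l = n)
    {x : P.X r n}, x ∈ G j r n → P.Δ g h x ∈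
      ⨆ t : {t : ℕ × ℕ // t.1 + t.2 = j},
        LinearMap.range (TensorProduct.map (G t.1.1 p m).subtype (G t.1.2 q l).subtype)

namespace DGPseudoCooperad.Grading

variable {k : Type u} [Field k] [CharZero k] {Ξ : Type v} {P : DGPseudoCooperad.{u, v, w} k Ξ}

/-- The subspaces `s (G j)` of the cobar construction. -/
def suspension (G : P.Grading) (j : ℕ) (r : Corolla Ξ) (m : ℤ) : Set (P.cobar.X r m) :=
  {y | ∃ (n : ℤ) (h : n + 1 = m), ∃ x ∈ G.G j r n, Free.gen h x = y}

/-- The vectors in `s (G 1)` are cocycles. -/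
theorem suspension_one_subset (G : P.Grading) (r : Corolla Ξ) (m : ℤ) :
    G.suspension 1 r m ⊆ P.cobar.cocycles r m := by
  rintro _ ⟨n, h, x, hx, rfl⟩
  refine (P.cobar.mem_cocycles rfl _).2 ?_
  have hd : P.d (rfl : n + 1 = n + 1) x = 0 := by
    have := G.d_mem (j := 0) rfl hx
    rwa [G.G_zero, Submodule.mem_bot] at this
  have hz : ∀ {p : Corolla Ξ} {i : ℤ} (j : ℕ) (a : G.G j p i), j = 0 → (a : P.X p i) = 0 := by
    rintro p i _ a rfl
    obtain ⟨a, ha⟩ := a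
    rwa [G.G_zero, Submodule.mem_bot] at ha
  have hΔ : ∀ {p q : Corolla Ξ} {i j : ℤ} (g : Graft p q r) (h : i + j = n),
      P.Δ g h x = 0 := by
    intro p q i j g h
    have := G.Δ_mem g h hx
    rw [← Submodule.mem_bot k]
    refine (iSup_le fun t => ?_ : _ ≤ (⊥ : Submodule k _)) this
    rintro _ ⟨y, rfl⟩
    rw [Submodule.mem_bot]
    induction y using TensorProduct.induction_on with
    | zero => simp
    | add a b ha hb => rw [map_add, ha, hb, add_zero]
    | tmul a b =>
      obtain ⟨⟨t₁, t₂⟩, ht⟩ := t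
      rw [TensorProduct.map_tmul]
      have h01 : t₁ = 0 ∨ t₂ = 0 := by
        change t₁ + t₂ = 1 at ht
        omega
      rcases h01 with h0 | h0
      · rw [Submodule.subtype_apply, hz _ a h0, TensorProduct.zero_tmul]
      · rw [Submodule.subtype_apply, Submodule.subtype_apply, hz _ b h0, TensorProduct.tmul_zero]
  change P.cobarD rfl (Free.gen h x) = 0
  rw [cobarD_gen, cobarGen, LinearMap.sub_apply, LinearMap.neg_apply, LinearMap.comp_apply, hd,
    map_zero, neg_zero, zero_sub, neg_eq_zero]
  exact finsum_eq_zero_of_forall_eq_zero fun t => by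
    rw [cobarTerm, LinearMap.comp_apply, hΔ, map_zero]

end DGPseudoCooperad.Grading

end OperadFormality

open OperadFormality

/-! The theorem is a dimension count. A morphism `F` of dg operads induces a morphism of cohomology
operads, so the image of `H(F)` is a suboperad of the cohomology of the target: it contains the
units and is stable under linear combinations, relabellings and insertions. By hypothesis the
classes of the `F`-images of certain cocycles generate that cohomology operad. These classes lie in
the image of `H(F)`, hence `H(F)` is surjective for every corolla and in every degree. This is
`Hom.mem_range_cohomologyMap`.

Injectivity comes from comparing dimensions. The quasi-isomorphism `ρ` gives, for every corolla and
degree, a linear isomorphism from the cohomology of the cobar construction to the cohomology of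
`H(O)`. The latter is `H(O)` itself, because its differential vanishes
(`cohomologyCohomologyEquiv`). Each component of `O` is finite dimensional, hence so is each
component of `H(O)`. Source and target of `H(F)` are therefore finite dimensional of equal
dimension, and a surjection between them is bijective. The isomorphism coming from `ρ` has no
relation to `H(F)`; only the equality of dimensions is extracted from it. This is
`Hom.isQuasiIso_of_isGeneratedBy`.

Over an extension `K` the same argument applies to `F` directly, so `F` need not be defined over
`k`. What has to be supplied is finite dimensionality and equality of dimensions over `K`. Both are
transported from `k` by the isomorphism `baseChangeCohomologyEquiv` between `K ⊗ H(A)` and `H(A ⊗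
K)`. It rests on the exactness of `K ⊗ -`: left exactness identifies the cocycles, right exactness
identifies the coboundaries among them. -/

namespace OperadFormality

namespace DGOperad

variable {k : Type u} [Field k] {Ξ : Type v}

/-! ### Surjectivity from generators, bijectivity from dimensions -/

/-- The image of a morphism on cohomology contains the suboperad generated by the classes of
images of cocycles. -/
theorem Hom.mem_range_cohomologyMap {A : DGOperad.{u, v, w₁} k Ξ} {B : DGOperad.{u, v, w₂} k Ξ}
    (F : Hom A B) (S : ∀ r n, Set (A.X r n)) {r : Corolla Ξ} {n : ℤ} {y : B.cohomology.X r n}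
    (hy : Generated B.cohomology (F.classes S) y) :
    ∃ x : A.Cohomology r n, F.cohomologyMap r n x = y := by
  -- Induction on the way `y` is built from the generating classes. The corolla and the degree vary
  -- along the induction, and each case says that the image of `H(F)` is closed under one operation
  -- of the operad.
  induction hy with
  | basic y hy =>
    -- Membership of `z` in `S` plays no role here: the class of the image of any cocycle is the
    -- image of its class.
    obtain ⟨z, -, rfl⟩ := hy
    exact ⟨A.proj z, rfl⟩
  | zero => exact ⟨0, map_zero _⟩
  | add y y' _ _ ih ih' =>
    obtain ⟨x, rfl⟩ := ih
    obtain ⟨x', rfl⟩ := ih'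
    exact ⟨x + x', map_add _ _ _⟩
  | smul a y _ ih =>
    obtain ⟨x, rfl⟩ := ih
    exact ⟨a • x, map_smul _ _ _⟩
  | act σ y _ ih =>
    obtain ⟨x, rfl⟩ := ih
    -- A cocycle representative is chosen because the action on cohomology is computed on
    -- representatives. There, `F` commutes with relabellings on the nose, so the two classes are
    -- projections of equal cocycles.
    obtain ⟨x, rfl⟩ := Submodule.Quotient.mk_surjective _ x
    exact ⟨A.proj ⟨A.act σ x, A.act_mem σ x.2⟩, congrArg B.proj (Subtype.ext (F.f_act σ _))⟩
  -- Units of the cohomology operad are classes of units, and these are cocycles in any dg operad.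
  | one c => exact ⟨A.proj ⟨A.one c, A.one_mem c⟩, congrArg B.proj (Subtype.ext (F.f_one c))⟩
  | comp g h y y' _ _ ih ih' =>
    obtain ⟨x, rfl⟩ := ih
    obtain ⟨x', rfl⟩ := ih'
    -- As for relabellings: insertion of classes is insertion of representing cocycles, which `F`
    -- respects strictly.
    obtain ⟨x, rfl⟩ := Submodule.Quotient.mk_surjective _ x
    obtain ⟨x', rfl⟩ := Submodule.Quotient.mk_surjective _ x'
    exact ⟨A.proj ⟨A.comp g h x x', A.comp_mem g h x.2 x'.2⟩,
      congrArg B.proj (Subtype.ext (F.f_comp g h _ _))⟩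

/-- A morphism is a quasi-isomorphism if the classes of images of cocycles generate the cohomology
of the target, which is finite dimensional and abstractly isomorphic to that of the source. -/
theorem Hom.isQuasiIso_of_isGeneratedBy {A : DGOperad.{u, v, w₁} k Ξ}
    {B : DGOperad.{u, v, w₂} k Ξ} (F : Hom A B) (S : ∀ r n, Set (A.X r n))
    (hS : B.cohomology.IsGeneratedBy (F.classes S))
    (hB : ∀ r n, Module.Finite k (B.Cohomology r n))
    (e : ∀ r n, Nonempty (A.Cohomology r n ≃ₗ[k] B.Cohomology r n)) : F.IsQuasiIso := by
  intro r n
  obtain ⟨e⟩ := e r n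
  have := hB r n
  -- Finiteness is assumed only for the target; the abstract isomorphism carries it to the source,
  -- where rank-nullity needs it too.
  have : Module.Finite k (A.Cohomology r n) := Module.Finite.equiv e.symm
  have hs : Function.Surjective (F.cohomologyMap r n) := fun y =>
    F.mem_range_cohomologyMap S (hS r n y)
  -- The only use of `e` beyond finiteness is the equality of the two dimensions, so it does not
  -- matter that `e` is not induced by `F`.
  exact ⟨(LinearMap.injective_iff_surjective_of_finrank_eq_finrank e.finrank_eq).2 hs, hs⟩

/-! ### Cohomology of a dg operad with zero differential -/

/-- The cohomology of the cohomology operad is the cohomology. -/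
noncomputable def cohomologyCohomologyEquiv (O : DGOperad.{u, v, w} k Ξ) (r : Corolla Ξ) (n : ℤ) :
    O.Cohomology r n ≃ₗ[k] O.cohomology.Cohomology r n :=
  LinearEquiv.ofBijective
    -- Every cohomology class is a cocycle of the operad `O.cohomology`, whose differential is zero
    -- by definition. The map sends a class to its own class.
    (O.cohomology.proj ∘ₗ LinearMap.codRestrict (O.cohomology.cocycles r n) LinearMap.id
      fun _ => LinearMap.mem_ker.2 rfl)
    ⟨by
      refine (injective_iff_map_eq_zero _).2 fun x hx => ?_
      obtain ⟨y, hy⟩ := (O.cohomology.mem_coboundaries (sub_add_cancel n 1) _).1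
        ((Submodule.Quotient.mk_eq_zero _).1 hx)
      -- The left side of `hy` is the zero differential applied to `y`, so `hy` reads `0 = x`: the
      -- only coboundary is zero.
      exact hy.symm,
    fun y => by
      obtain ⟨z, rfl⟩ := Submodule.Quotient.mk_surjective _ y
      exact ⟨z.1, rfl⟩⟩

/-! ### Cohomology commutes with extension of scalars -/

section BaseChange

variable (O : DGOperad.{u, v, w} k Ξ) (K : Type w₃) [Field K] [Algebra k K]

/-- The differential with values in the cocycles. -/
def toCocycles (r : Corolla Ξ) (n : ℤ) : O.X r (n - 1) →ₗ[k] O.cocycles r n :=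
  (O.d (sub_add_cancel n 1)).codRestrict _ fun x => LinearMap.mem_ker.2 (O.d_d _ _ x)

/-- The inclusion of the scalar extension of the cocycles into the cocycles of the scalar
extension. -/
def baseChangeCocycles (r : Corolla Ξ) (n : ℤ) :
    K ⊗[k] O.cocycles r n →ₗ[K] (O.baseChange K).cocycles r n :=
  LinearMap.codRestrict ((O.baseChange K).cocycles r n)
    ((O.cocycles r n).subtype.baseChange K : _ →ₗ[K] (O.baseChange K).X r n) fun x => by
    -- By functoriality of `K ⊗ -`, the extended differential after the extended inclusion is the
    -- extension of their composite, and the differential kills cocycles.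
    refine LinearMap.mem_ker.2
      ((LinearMap.lTensor_comp_apply K (O.d rfl) (O.cocycles r n).subtype x).symm.trans ?_)
    rw [show O.d rfl ∘ₗ (O.cocycles r n).subtype = 0 from LinearMap.ext fun x => x.2,
      LinearMap.lTensor_zero]
    rfl

/-- A vector space over a field is flat, so `K ⊗ -` preserves kernels. The cocycles are the kernel
of the differential: their inclusion stays injective after extension, and its image is still the
whole kernel. -/
theorem baseChangeCocycles_bijective (r : Corolla Ξ) (n : ℤ) :
    Function.Bijective (O.baseChangeCocycles K r n) := by
  constructor
  · intro x y h
    -- Forgetting that the values are cocycles turns the map into the extended inclusion, to which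
    -- flatness applies.
    exact Module.Flat.lTensor_preserves_injective_linearMap (M := K) (O.cocycles r n).subtype
      Subtype.val_injective (congrArg Subtype.val h)
  · rintro ⟨x, hx⟩
    -- Exactness of cocycles, cochains, next cochains survives the tensor product. The hypothesis
    -- `hx` says precisely that the extended differential annihilates `x`.
    obtain ⟨y, hy⟩ := (Module.Flat.lTensor_exact K (LinearMap.exact_subtype_ker_map
      (O.d (rfl : n + 1 = n + 1))) x).1 hx
    exact ⟨y, Subtype.ext hy⟩

/-- Coboundaries are by definition the values of the differential, and they form the kernel of the
projection to cohomology. Together with `proj_surjective` this presents cohomology as a cokernel of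
a map into the cocycles, the form in which right exactness of the tensor product can be used. -/
theorem exact_toCocycles_proj (r : Corolla Ξ) (n : ℤ) :
    Function.Exact (O.toCocycles r n) (O.proj (r := r) (n := n)) := fun x =>
  (Submodule.Quotient.mk_eq_zero _).trans <|
    (O.mem_coboundaries (sub_add_cancel n 1) x).trans
      -- The same `y` serves on both sides; the equation is read once among cochains and once among
      -- cocycles.
      ⟨fun ⟨y, hy⟩ => ⟨y, Subtype.ext hy⟩, fun ⟨y, hy⟩ => ⟨y, congrArg Subtype.val hy⟩⟩

theorem proj_surjective (r : Corolla Ξ) (n : ℤ) :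
    Function.Surjective (O.proj (r := r) (n := n)) :=
  Submodule.mkQ_surjective _

/-- By right exactness, the kernel of the extended projection consists of the values of the extended
`toCocycles`. Once the extended cocycles are identified with the cocycles of the extension, these
values are those of the extended differential. The equality is stated as an image of a submodule
because that is what an isomorphism of quotients requires. -/
theorem map_ker_baseChange_proj (r : Corolla Ξ) (n : ℤ) :
    (LinearMap.ker ((O.proj (r := r) (n := n)).baseChange K)).map (O.baseChangeCocycles K r n) =
      (O.baseChange K).coboundaries r n := by
  -- Here surjectivity of the projection is essential: this is right exactness of the tensor
  -- product, not flatness.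
  have hex := lTensor_exact K (O.exact_toCocycles_proj r n) (O.proj_surjective r n)
  -- The differential factors as `toCocycles` followed by the inclusion of the cocycles, and `K ⊗ -`
  -- respects this factorization.
  have hd (y : K ⊗[k] O.X r (n - 1)) :
      (O.baseChangeCocycles K r n ((O.toCocycles r n).lTensor K y) : (O.baseChange K).X r n) =
        (O.baseChange K).d (sub_add_cancel n 1) y :=
    (LinearMap.lTensor_comp_apply K (O.cocycles r n).subtype (O.toCocycles r n) y).symm
  refine Submodule.ext fun x =>
    Iff.trans ?_ ((O.baseChange K).mem_coboundaries (sub_add_cancel n 1) x).symm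
  constructor
  · rintro ⟨z, hz, rfl⟩
    obtain ⟨y, rfl⟩ := (hex z).1 hz
    exact ⟨y, (hd y).symm⟩
  · rintro ⟨y, hy⟩
    -- The omitted witness is the value of the extended `toCocycles` at `y`; exactness puts it in
    -- the kernel and `hd` computes its image.
    exact ⟨_, (hex _).2 ⟨y, rfl⟩, Subtype.ext ((hd y).trans hy)⟩

/-- Cohomology commutes with extension of scalars. -/
noncomputable def baseChangeCohomologyEquiv (r : Corolla Ξ) (n : ℤ) :
    K ⊗[k] O.Cohomology r n ≃ₗ[K] (O.baseChange K).Cohomology r n :=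
  -- The extended projection is still surjective, so `K ⊗ H` is the quotient of the extended
  -- cocycles by its kernel.
  (LinearMap.quotKerEquivOfSurjective ((O.proj (r := r) (n := n)).baseChange K)
    (LinearMap.lTensor_surjective K (O.proj_surjective r n))).symm.trans
    -- The isomorphism of cocycles matches this kernel with the coboundaries of the extension, hence
    -- descends to the quotients.
    (Submodule.Quotient.equiv _ _
      (LinearEquiv.ofBijective _ (O.baseChangeCocycles_bijective K r n))
      (O.map_ker_baseChange_proj K r n))

end BaseChange

end DGOperad

end OperadFormality

/-! ### The theorem over the base field and over its extensions -/

/-- If the image of `π_H ∘ F` on `s G¹ P` generates the cohomology operad, then `F` is a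
quasi-isomorphism; the same holds for morphisms that are defined over an extension `K` of the base
field `k`. -/
theorem mainTheorem9 {k : Type u} [Field k] [CharZero k] {Ξ : Type v}
    (O : DGOperad.{u, v, w₁} k Ξ) (P : DGPseudoCooperad.{u, v, w₂} k Ξ)
    (ρ : DGOperad.Hom P.cobar O.cohomology) (hρ : ρ.IsQuasiIso)
    -- the grading `G` of `P`
    (G : P.Grading)
    -- the conditions of finite dimension
    (hP : ∀ (j : ℕ) (r : Corolla Ξ), Module.Finite k (DirectSum ℤ fun n => G.G j r n))
    (hO : ∀ (r : Corolla Ξ) (n : ℤ), Module.Finite k (O.X r n))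
    -- the conditions on `ρ`
    (hρ₁ : O.cohomology.IsGeneratedBy fun r n => ρ.f '' G.suspension 1 r n)
    (hρ₂ : ∀ (j : ℕ) (r : Corolla Ξ) (n : ℤ), 2 ≤ j → ∀ y ∈ G.suspension j r n, ρ.f y = 0) :
    (∀ F : DGOperad.Hom P.cobar O,
      O.cohomology.IsGeneratedBy (F.classes (G.suspension 1)) → F.IsQuasiIso) ∧
    (∀ (K : Type w₃) [Field K] [Algebra k K]
      (F : DGOperad.Hom (P.cobar.baseChange K) (O.baseChange K)),
      (O.baseChange K).cohomology.IsGeneratedBy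
        (F.classes fun r n => (fun y => (1 : K) ⊗ₜ[k] y) '' G.suspension 1 r n) →
      F.IsQuasiIso) := by
  -- Cohomology is a quotient of a subspace of a finite dimensional space.
  have hfin : ∀ r n, Module.Finite k (O.Cohomology r n) := fun r n => by
    have := hO r n
    infer_instance
  -- The map induced by `ρ` ends in the cohomology of `H(O)`, which is then identified with `H(O)`.
  have e : ∀ r n, P.cobar.Cohomology r n ≃ₗ[k] O.Cohomology r n := fun r n =>
    (LinearEquiv.ofBijective _ (hρ r n)).trans (O.cohomologyCohomologyEquiv r n).symm
  refine ⟨fun F hF => F.isQuasiIso_of_isGeneratedBy _ hF hfin fun r n => ⟨e r n⟩,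
    -- Over `K` the criterion is applied to `F` itself. What remains is finite dimensionality over
    -- `K` and an abstract isomorphism of the two cohomologies.
    fun K _ _ F hF => F.isQuasiIso_of_isGeneratedBy _ hF (fun r n => ?_) fun r n => ⟨?_⟩⟩
  · have := hfin r n
    exact Module.Finite.equiv (O.baseChangeCohomologyEquiv K r n)
  -- Cohomology of the extended cobar construction is the extension of its cohomology, which `e`
  -- carries to the extension of `H(O)`, hence to the cohomology of the extension of `O`.
  · exact (P.cobar.baseChangeCohomologyEquiv K r n).symm.trans
      (((e r n).baseChange k K _ _).trans (O.baseChangeCohomologyEquiv K r n))
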